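/- Let $(V,E)$ be an infinite, connected, locally finite, simple undirected graph with edge weights $w_{xy}=w_{yx}>0$ for $x\sim y$ (put $w_{xy}=0$ otherwise) and vertex weights $m_x>0$. Write $|\Omega|=\sum_{x\in\Omega}m_x\in[0,\infty]$ for $\Omega\subset V$, and $\Delta f(x)=\sum_{y}\frac{w_{xy}}{m_x}(f(y)-f(x))$. Let $\rho$ be a (pseudo) metric on $V$ such that - $\rho$ is intrinsic: $\sum_{y}w_{xy}\rho^2(x,y)\le m_x$ for all $x\in V$; - all balls $\{y:\rho(y,x)\le R\}$, $x\in V$, $0<R<\infty$, are finite; - the jump size $s=\sup_{x\sim y}\rho(x,y)$ is finite. Fix $x_0\in V$ and put $r(x)=\rho(x,x_0)$. Let $\Pi\subset V$ be an end, i.e. an infinite connected component of the subgraph induced on $V\setminus\Omega$ for some finite $\Omega\subset V$. Let $\partial\Pi$ be the set of $y\in V\setminus\Pi$ with a neighbour in $\Pi$, let $\Pi_R=\{x\in\Pi: r(x)\le R\}$ and $\Pi_{R_1}^{R_2}=\{x\in\Pi: R_1\le r(x)\le R_2\}$. Let $$\mu_1(\Pi)=\inf_f\frac{\frac12\sum_{x,y\in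 V}w_{xy}|f(x)-f(y)|^2}{\sum_{x\in V}f^2(x)m_x},$$ the infimum being over all $f:V\to\mathbb R$, $f\ne0$, with finite support contained in $\Pi$; this is the bottom of the spectrum of the Laplacian with Dirichlet boundary condition on $\Pi$. Assume $\mu_1(\Pi)>0$ and set $a=a_0(\mu_1(\Pi))$, where, $d$ denoting the combinatorial graph distance, $$a_0(t)=\begin{cases}\frac1s\log\bigl(1+s\sqrt{2t}\bigr), & \rho\ne d,\\[2pt] \log\frac1{1-t}+\log\bigl(1+\sqrt{1-(1-t)^2}\bigr), & \rho=d\end{cases}$$ (if $\rho=d$, then automatically $\mu_1(\Pi)<1$). The end $\Pi$ is called non-parabolic if there is $f:\Pi\cup\partial\Pi\to(0,\infty)$ with $\Delta f=0$ on $\Pi$, $f=1$ on $\partial\Pi$ and $\liminf_{x\to\infty,\,x\in\Pi}f(x)<1$, where $x\to\infty$ means that $x$ leaves every finite set; otherwise $\Pi$ is called parabolic. Let $R_0\in\mathbb R$ satisfy $R_0\ge r(x)$ for all $x\in\partial\Pi$. Then the following are equivalent: 1. $\Pi$ is parabolic. 2. There is a sequence $R_i\to\infty$ such that $\sum_{x\in\Pi_{R_i}^{R_i+3s}}e^{-2ar(x)}m_x\to0$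 as $i\to\infty$. 3. $|\Pi|<\infty$. 4. There is a constant $C>0$ such that for all $R\ge R_0+3s$, $$|\Pi_R^{R+3s}|\le Ce^{-2a(R-R_0)}|\Pi_{R_0}^{R_0+3s}|.$$ 5. There is a constant $C>0$ such that for all $R\ge R_0+3s$, $$|\Pi|-|\Pi_R|\le Ce^{-2a(R-R_0)}|\Pi_{R_0}^{R_0+3s}|.$$ -/

import Mathlib

open Filter Topology
open scoped ENNReal

noncomputable section

/-- A weighted graph `(V, E, m, w)`: a connected, locally finite, simple, undirected graph with
positive symmetric edge weights `w` (extended by zero to pairs of non-neighbours) and positive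
vertex weights `m`. -/
structure WeightedGraph (V : Type*) where
  graph : SimpleGraph V
  connected : graph.Connected
  locallyFinite : ∀ x, (graph.neighborSet x).Finite
  w : V → V → ℝ
  w_symm : ∀ x y, w x y = w y x
  w_pos : ∀ x y, graph.Adj x y → 0 < w x y
  w_eq_zero : ∀ x y, ¬ graph.Adj x y → w x y = 0
  m : V → ℝ
  m_pos : ∀ x, 0 < m x

namespace WeightedGraph

variable {V : Type*} (G : WeightedGraph V)

/-- The Laplace operator `Δf(x) = ∑_y (w_{xy} / m_x) (f(y) - f(x))`; by local finiteness all but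
finitely many terms vanish. -/
def laplacian (f : V → ℝ) (x : V) : ℝ :=
  ∑' y, G.w x y / G.m x * (f y - f x)

/-- The `m`-measure `|Ω| = ∑_{x ∈ Ω} m_x ∈ [0, ∞]`. -/
def vol (Ω : Set V) : ℝ≥0∞ :=
  ∑' x : Ω, ENNReal.ofReal (G.m x)

/-- The combinatorial distance, as a real number. -/
def combDist (x y : V) : ℝ := (G.graph.dist x y : ℝ)

/-- The Dirichlet energy `½ ∑_{x,y} w_{xy} |f(x) - f(y)|²` (used for finitely supported `f`). -/
def energy (f : V → ℝ) : ℝ :=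
  1 / 2 * ∑' p : V × V, G.w p.1 p.2 * |f p.1 - f p.2| ^ 2

/-- The bottom `μ₁(Ω)` of the spectrum of the Laplacian with Dirichlet boundary condition on `Ω`:
the infimum of the Rayleigh quotients of the nonzero functions with finite support contained
in `Ω`. -/
def mu1 (Ω : Set V) : ℝ :=
  sInf {q : ℝ | ∃ f : V → ℝ, f.support.Finite ∧ f.support ⊆ Ω ∧ f ≠ 0 ∧
    q = G.energy f / ∑' x, f x ^ 2 * G.m x}

/-- The vertex boundary `∂K`. -/
def boundary (K : Set V) : Set V :=
  {y | y ∉ K ∧ ∃ x ∈ K, G.graph.Adj y x}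

/-- `P` is an end of `G`: an infinite connected component of the subgraph induced on `V \ Ω`
for some finite `Ω`. -/
def IsEnd (P : Set V) : Prop :=
  ∃ Ω : Set V, Ω.Finite ∧ (∃ K : G.graph.ComponentCompl Ω, K.supp = P) ∧ P.Infinite

/-- `f` (of which only the values on `P ∪ ∂P` matter) is a barrier function on `P`: it is positive
on `P ∪ ∂P`, harmonic on `P`, equal to `1` on `∂P`, and its lower limit, as `x ∈ P` leaves every
finite set, is less than `1`. The lower limit is taken in the extended reals. -/
def IsBarrier (P : Set V) (f : V → ℝ) : Prop :=
  (∀ x ∈ P ∪ G.boundary P, 0 < f x) ∧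
  (∀ x ∈ P, G.laplacian f x = 0) ∧
  (∀ x ∈ G.boundary P, f x = 1) ∧
  liminf (fun x => (f x : EReal)) (cofinite ⊓ 𝓟 P) < 1

/-- `P` is parabolic: there is no barrier function on `P`. -/
def IsParabolic (P : Set V) : Prop :=
  ¬ ∃ f : V → ℝ, G.IsBarrier P f

/-- `ρ` is an intrinsic (pseudo) metric on `G`. -/
structure IsIntrinsicMetric (ρ : V → V → ℝ) : Prop where
  nonneg : ∀ x y, 0 ≤ ρ x y
  self : ∀ x, ρ x x = 0
  symm : ∀ x y, ρ x y = ρ y x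
  triangle : ∀ x y z, ρ x z ≤ ρ x y + ρ y z
  intrinsic : ∀ x, ∑' y, G.w x y * ρ x y ^ 2 ≤ G.m x

/-- The set of the `ρ`-lengths of the edges. -/
def edgeLengths (ρ : V → V → ℝ) : Set ℝ :=
  {t | ∃ x y, G.graph.Adj x y ∧ t = ρ x y}

/-- The jump size `s = sup_{x ∼ y} ρ(x, y)`. -/
def jumpSize (ρ : V → V → ℝ) : ℝ := sSup (G.edgeLengths ρ)

/-- An intrinsic metric with finite balls and finite jump size. -/
structure IsAdmissibleMetric (ρ : V → V → ℝ) : Prop where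
  isIntrinsicMetric : G.IsIntrinsicMetric ρ
  finite_ball : ∀ (x : V) (R : ℝ), 0 < R → {y | ρ y x ≤ R}.Finite
  finite_jump : BddAbove (G.edgeLengths ρ)

open Classical in
/-- The function `a_μ(t)`; it is meant for `t > μ`, and for `μ < t < 1` if `ρ` is the
combinatorial distance. -/
def aCoeff (ρ : V → V → ℝ) (μ t : ℝ) : ℝ :=
  if ρ = G.combDist then
    Real.log ((1 - μ) / (1 - t)) + Real.log (1 + Real.sqrt (1 - ((1 - t) / (1 - μ)) ^ 2))
  else
    1 / G.jumpSize ρ * Real.log (1 + G.jumpSize ρ * Real.sqrt (2 * (t - μ)))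

end WeightedGraph

/-- `P_R = {x ∈ P : ρ(x, x₀) ≤ R}`. -/
def ballPart {V : Type*} (ρ : V → V → ℝ) (x₀ : V) (P : Set V) (R : ℝ) : Set V :=
  {x ∈ P | ρ x x₀ ≤ R}

/-- `P_{R₁}^{R₂} = {x ∈ P : R₁ ≤ ρ(x, x₀) ≤ R₂}`. -/
def annulusPart {V : Type*} (ρ : V → V → ℝ) (x₀ : V) (P : Set V) (R₁ R₂ : ℝ) : Set V :=
  {x ∈ P | R₁ ≤ ρ x x₀ ∧ ρ x x₀ ≤ R₂}

end

/-! Write $\mu=\mu_1(\Pi)$. The exponent $a$ is chosen so that $\psi=e^{ag}$, for any $g$ with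
$|g(x)-g(y)|\le\rho(x,y)$, satisfies on every edge
$(\psi(x)-\psi(y))^2\le\mu\rho(x,y)^2(\psi(x)^2+\psi(y)^2)$ (`exp_edge_estimate`). Summed with the
intrinsic condition, this bounds the energy of $\psi$ in a region by $\mu\sum\psi^2m$ over that
region. Hence, when the Rayleigh inequality is applied to $\psi$ cut off on $\Pi$, the part where
$g$ varies is absorbed exactly. The sum of $\psi^2m$ over the part where $g$ is locally constant is
then controlled by edges at $\partial\Pi$ and by a cutoff annulus of width $3s$ (`agmon_estimate`).

Two choices of $g$ give the volume statements. With $g=-(r-R')_+$ the annulus term is the sum in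
(2), so it vanishes along the sequence and $|\Pi|<\infty$. With $g=\min(r,R')$ and $|\Pi|<\infty$,
the annulus term is small far out, and the volume beyond radius $R$ is $O(e^{-2aR})$.

Parabolicity is tied to finite volume in two ways. If $|\Pi|<\infty$ and $f$ is a barrier, then
$(1-f)_+$, extended by zero, is bounded and subharmonic where positive; a Caccioppoli inequality
with cutoffs of slope $1/k$ gives $(1-f)_+=0$, a contradiction. Conversely, the equilibrium
potential $u$ of $\partial\Pi$ has $\sum_\Pi u^2m<\infty$ because $\mu>0$. On a parabolic end $u$ is
not a barrier, so $u>1/2$ off a finite set and the volume is finite. -/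

namespace WeightedGraph

/-! ### Finite-sum forms of the Laplacian, the energy and the volume -/

section Basic

variable {V : Type*} (G : WeightedGraph V)

theorem w_nonneg (x y : V) : 0 ≤ G.w x y := by
  by_cases h : G.graph.Adj x y
  · exact (G.w_pos x y h).le
  · exact (G.w_eq_zero x y h).ge

theorem w_self (x : V) : G.w x x = 0 := G.w_eq_zero x x (G.graph.loopless.irrefl x)

/-- The finite set of the neighbours of `x`. -/
noncomputable def nbr (x : V) : Finset V := (G.locallyFinite x).toFinset

theorem mem_nbr {x y : V} : y ∈ G.nbr x ↔ G.graph.Adj x y := by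
  simp [nbr]

open Classical in
/-- The vertices of `F` together with their neighbours. -/
noncomputable def closedNbhd (F : Finset V) : Finset V := F ∪ F.biUnion G.nbr

theorem subset_closedNbhd (F : Finset V) : F ⊆ G.closedNbhd F := by
  classical
  exact Finset.subset_union_left

theorem mem_closedNbhd_of_adj {F : Finset V} {x y : V} (hx : x ∈ F) (h : G.graph.Adj x y) :
    y ∈ G.closedNbhd F := by
  classical
  exact Finset.mem_union_right _ (Finset.mem_biUnion.2 ⟨x, hx, G.mem_nbr.2 h⟩)

theorem nbr_subset_closedNbhd {F : Finset V} {x : V} (hx : x ∈ F) :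
    G.nbr x ⊆ G.closedNbhd F := fun _ hy => G.mem_closedNbhd_of_adj hx (G.mem_nbr.1 hy)

theorem laplacian_eq_sum (f : V → ℝ) {x : V} {N : Finset V} (hN : G.nbr x ⊆ N) :
    G.laplacian f x = (∑ y ∈ N, G.w x y * (f y - f x)) / G.m x := by
  unfold laplacian
  rw [tsum_eq_sum (s := N), Finset.sum_div]
  · exact Finset.sum_congr rfl fun y _ => by ring
  · intro y hy
    have : ¬ G.graph.Adj x y := fun h => hy (hN (G.mem_nbr.2 h))
    simp [G.w_eq_zero x y this]

theorem sum_w_mul_le_of_tsum_le {x : V} {c : V → ℝ} (hc : ∀ y, 0 ≤ c y) {M : ℝ}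
    (h : ∑' y, G.w x y * c y ≤ M) (N : Finset V) : ∑ y ∈ N, G.w x y * c y ≤ M := by
  refine le_trans (Summable.sum_le_tsum N (fun y _ => mul_nonneg (G.w_nonneg x y) (hc y)) ?_) h
  refine summable_of_ne_finset_zero (s := G.nbr x) fun y hy => ?_
  simp [G.w_eq_zero x y fun hxy => hy (G.mem_nbr.2 hxy)]

/-- On a sufficiently large finite set the energy of a finitely supported function is a finite
sum. -/
theorem energy_eq_sum {f : V → ℝ} {F N : Finset V} (hf : ∀ x, x ∉ F → f x = 0)
    (hN : G.closedNbhd F ⊆ N) :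
    G.energy f = 1 / 2 * ∑ x ∈ N, ∑ y ∈ N, G.w x y * (f x - f y) ^ 2 := by
  unfold energy
  rw [tsum_eq_sum (s := N ×ˢ N), Finset.sum_product]
  · simp only [sq_abs]
  · rintro ⟨x, y⟩ hp
    by_cases hxy : G.graph.Adj x y
    · have hx : x ∉ F := fun hx => hp (Finset.mem_product.2
        ⟨hN (G.subset_closedNbhd F hx), hN (G.mem_closedNbhd_of_adj hx hxy)⟩)
      have hy : y ∉ F := fun hy => hp (Finset.mem_product.2
        ⟨hN (G.mem_closedNbhd_of_adj hy hxy.symm), hN (G.subset_closedNbhd F hy)⟩)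
      simp [hf x hx, hf y hy]
    · simp [G.w_eq_zero x y hxy]

theorem energy_nonneg (f : V → ℝ) : 0 ≤ G.energy f :=
  mul_nonneg (by norm_num) (tsum_nonneg fun p => mul_nonneg (G.w_nonneg _ _) (by positivity))

theorem mu1_le {P : Set V} {f : V → ℝ} (hfin : f.support.Finite) (hP : f.support ⊆ P)
    (hf : f ≠ 0) : G.mu1 P ≤ G.energy f / ∑' x, f x ^ 2 * G.m x := by
  refine csInf_le ⟨0, ?_⟩ ⟨f, hfin, hP, hf, rfl⟩
  rintro q ⟨h, -, -, -, rfl⟩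
  exact div_nonneg (G.energy_nonneg h)
    (tsum_nonneg fun x => mul_nonneg (sq_nonneg _) (G.m_pos x).le)

/-- The Dirichlet eigenvalue estimate for finitely supported functions. -/
theorem mu1_mul_sum_le_energy {P : Set V} {f : V → ℝ} {F : Finset V}
    (hf : ∀ x, x ∉ F → f x = 0) (hP : ∀ x, x ∉ P → f x = 0) :
    G.mu1 P * ∑ x ∈ F, f x ^ 2 * G.m x ≤ G.energy f := by
  by_cases h0 : f = 0
  · simpa [h0] using G.energy_nonneg 0
  have hsum : ∑' x, f x ^ 2 * G.m x = ∑ x ∈ F, f x ^ 2 * G.m x :=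
    tsum_eq_sum fun x hx => by simp [hf x hx]
  obtain ⟨x, hx⟩ := Function.ne_iff.1 h0
  have hxF : x ∈ F := by
    by_contra h
    exact hx (hf x h)
  have hpos : 0 < ∑ x ∈ F, f x ^ 2 * G.m x :=
    Finset.sum_pos' (fun y _ => mul_nonneg (sq_nonneg _) (G.m_pos y).le)
      ⟨x, hxF, mul_pos (by simpa using sq_pos_of_ne_zero hx) (G.m_pos x)⟩
  have := G.mu1_le (P := P) (f := f)
    (F.finite_toSet.subset fun y hy => by_contra fun h => hy (hf y h))
    (fun y hy => by_contra fun h => hy (hP y h)) h0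
  rw [hsum, le_div_iff₀ hpos] at this
  exact this

theorem sum_le_vol {Ω : Set V} {F : Finset V} (hF : ∀ x ∈ F, x ∈ Ω) :
    ENNReal.ofReal (∑ x ∈ F, G.m x) ≤ G.vol Ω := by
  rw [ENNReal.ofReal_sum_of_nonneg fun x _ => (G.m_pos x).le]
  unfold vol
  have h : ∑ x ∈ F, ENNReal.ofReal (G.m x)
      = ∑ x ∈ F.attach.map ⟨fun x => (⟨x.1, hF x.1 x.2⟩ : Ω), fun x y h =>
          Subtype.ext (Subtype.mk.inj h)⟩, ENNReal.ofReal (G.m x) := by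
    rw [Finset.sum_map]
    exact (Finset.sum_attach F fun x => ENNReal.ofReal (G.m x)).symm
  rw [h]
  exact ENNReal.sum_le_tsum _

theorem sum_le_toReal_vol {Ω : Set V} (hΩ : G.vol Ω < ∞) {F : Finset V} (hF : ∀ x ∈ F, x ∈ Ω) :
    ∑ x ∈ F, G.m x ≤ (G.vol Ω).toReal :=
  (ENNReal.ofReal_le_iff_le_toReal hΩ.ne).1 (G.sum_le_vol hF)

theorem tsum_subtype_ofReal_eq (c : V → ℝ) (hc : ∀ x, 0 ≤ c x) (F : Finset V) {Ω : Set V}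
    (hF : ∀ x, x ∈ F ↔ x ∈ Ω) :
    ∑' x : Ω, ENNReal.ofReal (c x) = ENNReal.ofReal (∑ x ∈ F, c x) := by
  have : Ω = ↑F := Set.ext fun x => (hF x).symm
  subst this
  rw [ENNReal.ofReal_sum_of_nonneg fun x _ => hc x]
  exact Finset.tsum_subtype F fun x => ENNReal.ofReal (c x)

theorem vol_le_of_forall_sum_le {Ω : Set V} {c : ℝ}
    (h : ∀ F : Finset V, (∀ x ∈ F, x ∈ Ω) → ∑ x ∈ F, G.m x ≤ c) :
    G.vol Ω ≤ ENNReal.ofReal c := by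
  classical
  unfold vol
  rw [ENNReal.tsum_eq_iSup_sum]
  refine iSup_le fun F => ?_
  have := h (F.image Subtype.val) (by simp +contextual)
  rw [Finset.sum_image (by simp)] at this
  rw [← ENNReal.ofReal_sum_of_nonneg fun (x : Ω) _ => (G.m_pos x).le]
  exact ENNReal.ofReal_le_ofReal this

theorem vol_mono {Ω Ω' : Set V} (h : Ω ⊆ Ω') : G.vol Ω ≤ G.vol Ω' :=
  ENNReal.tsum_mono_subtype (fun x => ENNReal.ofReal (G.m x)) h

theorem vol_lt_top_of_finite {Ω : Set V} (h : Ω.Finite) : G.vol Ω < ∞ := by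
  unfold vol
  rw [tsum_subtype_ofReal_eq G.m (fun x => (G.m_pos x).le) h.toFinset (by simp)]
  exact ENNReal.ofReal_lt_top

theorem vol_pos_of_nonempty {Ω : Set V} (h : Ω.Nonempty) : 0 < G.vol Ω := by
  obtain ⟨x, hx⟩ := h
  refine lt_of_lt_of_le ?_ (G.sum_le_vol (Ω := Ω) (F := {x}) (by simpa))
  simpa using G.m_pos x

end Basic

/-! ### The exponent $a$ and the edgewise exponential estimate -/

section EdgeEstimate

variable {V : Type*} (G : WeightedGraph V)

theorem IsAdmissibleMetric.le_jumpSize {G : WeightedGraph V} {ρ : V → V → ℝ}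
    (hρ : G.IsAdmissibleMetric ρ) {x y : V} (h : G.graph.Adj x y) : ρ x y ≤ G.jumpSize ρ :=
  le_csSup hρ.finite_jump ⟨x, y, h, rfl⟩

theorem IsIntrinsicMetric.abs_sub_le {G : WeightedGraph V} {ρ : V → V → ℝ}
    (hρ : G.IsIntrinsicMetric ρ) (x₀ x y : V) : |ρ x x₀ - ρ y x₀| ≤ ρ x y := by
  have h1 := hρ.triangle x y x₀
  have h2 := hρ.triangle y x x₀
  rw [hρ.symm y x] at h2
  rw [abs_le]
  constructor <;> linarith

theorem IsAdmissibleMetric.finite_le {G : WeightedGraph V} {ρ : V → V → ℝ}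
    (hρ : G.IsAdmissibleMetric ρ) (x : V) (R : ℝ) : {y | ρ y x ≤ R}.Finite :=
  (hρ.finite_ball x (max R 1) (by positivity)).subset fun y (hy : ρ y x ≤ R) =>
    show ρ y x ≤ max R 1 from hy.trans (le_max_left _ _)

/-- With $s\le0$ the triangle inequality along walks would place all of the infinite set $V$ in one
finite ball. -/
theorem IsAdmissibleMetric.jumpSize_pos [Infinite V] {G : WeightedGraph V} {ρ : V → V → ℝ}
    (hρ : G.IsAdmissibleMetric ρ) : 0 < G.jumpSize ρ := by
  by_contra! hs
  obtain ⟨x⟩ : Nonempty V := inferInstance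
  have hzero : ∀ y, ρ y x ≤ 0 := by
    intro y
    obtain ⟨p⟩ := G.connected.preconnected y x
    induction p with
    | nil => exact (hρ.isIntrinsicMetric.self _).le
    | cons h p ih =>
      exact (hρ.isIntrinsicMetric.triangle _ _ _).trans
        (add_nonpos ((hρ.le_jumpSize h).trans hs) ih)
  exact Set.infinite_univ ((hρ.finite_le x 0).subset fun y _ => hzero y)

theorem combDist_of_adj {x y : V} (h : G.graph.Adj x y) : G.combDist x y = 1 := by
  simp [combDist, SimpleGraph.dist_eq_one_iff_adj.2 h]

theorem sq_exp_sub_one_le_of_log {μ s a : ℝ} (hμ : 0 < μ) (hs : 0 < s)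
    (ha : a = 1 / s * Real.log (1 + s * √(2 * μ))) {t : ℝ} (ht0 : 0 ≤ t) (hts : t ≤ s) :
    (Real.exp (a * t) - 1) ^ 2 ≤ 2 * μ * t ^ 2 := by
  have hE : Real.exp (a * s) = 1 + s * √(2 * μ) := by
    rw [ha, show 1 / s * Real.log (1 + s * √(2 * μ)) * s = Real.log (1 + s * √(2 * μ)) by
      field_simp, Real.exp_log (by positivity)]
  have ha0 : 0 ≤ a := by
    rw [ha]
    exact mul_nonneg (by positivity) (Real.log_nonneg (by
      have : 0 ≤ s * √(2 * μ) := by positivity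
      linarith))
  -- Convexity: on $[0,s]$ the exponential lies below its chord, and $a$ is defined so that this
  -- chord has slope $\sqrt{2\mu}$.
  have hconv : Real.exp (a * t) ≤ 1 + t * √(2 * μ) := by
    have h := convexOn_exp.2 (Set.mem_univ (0 : ℝ)) (Set.mem_univ (a * s))
      (sub_nonneg.2 ((div_le_one hs).2 hts)) (show 0 ≤ t / s by positivity) (by ring)
    simp only [smul_eq_mul, mul_zero, zero_add, Real.exp_zero, mul_one, hE] at h
    rw [show t / s * (a * s) = a * t by field_simp] at h
    calc Real.exp (a * t) ≤ _ := h
      _ = 1 + t * √(2 * μ) := by field_simp; ring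
  have h1 : 0 ≤ Real.exp (a * t) - 1 := by
    have := Real.one_le_exp (mul_nonneg ha0 ht0)
    linarith
  calc (Real.exp (a * t) - 1) ^ 2 ≤ (t * √(2 * μ)) ^ 2 := by
        apply pow_le_pow_left₀ h1
        linarith
    _ = 2 * μ * t ^ 2 := by
        rw [mul_pow, Real.sq_sqrt (by positivity)]
        ring

/-- With $c=1-\mu$ and $z=e^{at}$ the inequality reads $cz^2-2z+c\le0$. The roots of this quadratic
are $e^{a}$ and $e^{-a}$, since $\cosh a=1/c$, and $z$ lies between them. -/
theorem sq_exp_sub_one_le_of_cosh {μ a : ℝ} (hμ : 0 < μ) (hμ1 : μ < 1)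
    (ha : a = Real.log (1 / (1 - μ)) + Real.log (1 + √(1 - (1 - μ) ^ 2)))
    {t : ℝ} (ht0 : 0 ≤ t) (ht1 : t ≤ 1) :
    0 < a ∧ (Real.exp (a * t) - 1) ^ 2 ≤ μ * (1 + Real.exp (a * t) ^ 2) := by
  set c := 1 - μ with hc
  have hc0 : 0 < c := by simp only [hc]; linarith
  have hc1 : c < 1 := by simp only [hc]; linarith
  set q := √(1 - c ^ 2) with hq
  have hq0 : 0 ≤ q := Real.sqrt_nonneg _
  have hq2 : q ^ 2 = 1 - c ^ 2 := Real.sq_sqrt (by nlinarith)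
  have hE : Real.exp a = (1 + q) / c := by
    rw [ha, Real.exp_add, Real.exp_log (by positivity), Real.exp_log (by positivity)]
    ring
  have hE1 : 1 < Real.exp a := by
    rw [hE, lt_div_iff₀ hc0]
    linarith
  have ha0 : 0 < a := by simpa using hE1
  refine ⟨ha0, ?_⟩
  have hz1 : 1 ≤ Real.exp (a * t) := Real.one_le_exp (by positivity)
  have hzE : Real.exp (a * t) ≤ Real.exp a := Real.exp_le_exp.2 (by nlinarith)
  have hEq : c * (Real.exp a ^ 2 + 1) = 2 * Real.exp a := by
    rw [hE]
    field_simp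
    nlinarith
  have hμc : μ = 1 - c := by simp [hc]
  set z := Real.exp (a * t)
  set E := Real.exp a
  have hEpos : 0 < E := by linarith
  have hprod : c * ((E * z - 1) * (z - E)) ≤ 0 := by
    apply mul_nonpos_of_nonneg_of_nonpos hc0.le
    apply mul_nonpos_of_nonneg_of_nonpos <;> nlinarith
  have : E * (c * z ^ 2 - 2 * z + c) ≤ 0 := by
    have : E * (c * z ^ 2 - 2 * z + c) = c * ((E * z - 1) * (z - E))
      + z * (c * (E ^ 2 + 1) - 2 * E) := by ring
    rw [this, hEq]
    linarith
  have : c * z ^ 2 - 2 * z + c ≤ 0 := by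
    by_contra! h
    have := mul_pos hEpos h
    linarith
  rw [hμc]
  nlinarith

/-- The weight `e^{a r}` satisfies, edge by edge, the estimate that matches the bottom of the
spectrum. -/
theorem exp_edge_estimate [Infinite V] {ρ : V → V → ℝ} (hρ : G.IsAdmissibleMetric ρ) {μ a : ℝ}
    (hμ : 0 < μ) (hμ1 : ρ = G.combDist → μ < 1) (ha : a = G.aCoeff ρ 0 μ) :
    0 < a ∧ ∀ x y, G.graph.Adj x y → ∀ p q : ℝ, |p - q| ≤ ρ x y →
      (Real.exp (a * p) - Real.exp (a * q)) ^ 2 ≤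
        μ * ρ x y ^ 2 * (Real.exp (a * p) ^ 2 + Real.exp (a * q) ^ 2) := by
  have hs := hρ.jumpSize_pos
  have key : 0 < a ∧ ∀ x y, G.graph.Adj x y → ∀ t : ℝ, 0 ≤ t → t ≤ ρ x y →
      (Real.exp (a * t) - 1) ^ 2 ≤ μ * ρ x y ^ 2 * (1 + Real.exp (a * t) ^ 2) := by
    unfold aCoeff at ha
    split_ifs at ha with hd
    · simp only [sub_zero, div_one] at ha
      refine ⟨(sq_exp_sub_one_le_of_cosh hμ (hμ1 hd) ha le_rfl zero_le_one).1,
        fun x y hxy t ht0 ht => ?_⟩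
      rw [hd, G.combDist_of_adj hxy] at ht ⊢
      simpa using (sq_exp_sub_one_le_of_cosh hμ (hμ1 hd) ha ht0 ht).2
    · rw [sub_zero] at ha
      have hsq : 0 < G.jumpSize ρ * √(2 * μ) := by positivity
      have ha0 : 0 < a := by
        rw [ha]
        exact mul_pos (by positivity) (Real.log_pos (by linarith))
      refine ⟨ha0, fun x y hxy t ht0 ht => ?_⟩
      have h1 := sq_exp_sub_one_le_of_log hμ hs ha ht0 (ht.trans (hρ.le_jumpSize hxy))
      have h2 : 1 ≤ Real.exp (a * t) ^ 2 := one_le_pow₀ (Real.one_le_exp (by positivity))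
      have h3 : t ^ 2 ≤ ρ x y ^ 2 := pow_le_pow_left₀ ht0 ht 2
      calc _ ≤ 2 * μ * t ^ 2 := h1
        _ ≤ 2 * μ * ρ x y ^ 2 := by gcongr
        _ = μ * ρ x y ^ 2 * 2 := by ring
        _ ≤ _ := by
          gcongr
          linarith
  refine ⟨key.1, fun x y hxy p q hpq => ?_⟩
  have main : ∀ p q : ℝ, q ≤ p → |p - q| ≤ ρ x y →
      (Real.exp (a * p) - Real.exp (a * q)) ^ 2 ≤
        μ * ρ x y ^ 2 * (Real.exp (a * p) ^ 2 + Real.exp (a * q) ^ 2) := by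
    intro p q hle hpq
    rw [abs_of_nonneg (by linarith)] at hpq
    have h := key.2 x y hxy (p - q) (by linarith) hpq
    have hp : Real.exp (a * p) = Real.exp (a * q) * Real.exp (a * (p - q)) := by
      rw [← Real.exp_add]
      ring_nf
    rw [hp]
    calc _ = Real.exp (a * q) ^ 2 * (Real.exp (a * (p - q)) - 1) ^ 2 := by ring
      _ ≤ Real.exp (a * q) ^ 2 * (μ * ρ x y ^ 2 * (1 + Real.exp (a * (p - q)) ^ 2)) := by
        gcongr
      _ = _ := by ring
  rcases le_total q p with h | h
  · exact main p q h hpq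
  · have := main q p h (by rwa [abs_sub_comm])
    linarith [sq_nonneg (Real.exp (a * p) - Real.exp (a * q))]

/-- If the combinatorial distance is intrinsic, the bottom of the spectrum of a set that contains
an edge is less than one. -/
theorem mu1_lt_one_of_combDist {ρ : V → V → ℝ} (hρ : G.IsIntrinsicMetric ρ)
    (hd : ρ = G.combDist) {P : Set V} {x y : V} (hx : x ∈ P) (hy : y ∈ P)
    (hxy : G.graph.Adj x y) : G.mu1 P < 1 := by
  classical
  have hne : x ≠ y := hxy.ne
  set f : V → ℝ := fun z => if z = x ∨ z = y then 1 else 0 with hf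
  set F : Finset V := {x, y} with hF
  have hfx : f x = 1 := by simp [hf]
  have hfy : f y = 1 := by simp [hf]
  have hf0 : ∀ z, z ∉ F → f z = 0 := fun z hz => by
    simpa [hf, hF] using hz
  have h1 := G.mu1_mul_sum_le_energy (P := P) hf0 (fun z hz => by
    have h1 : z ≠ x := fun h => hz (h ▸ hx)
    have h2 : z ≠ y := fun h => hz (h ▸ hy)
    simp [hf, h1, h2])
  rw [G.energy_eq_sum hf0 le_rfl, hF, Finset.sum_pair hne, hfx, hfy, ← hF] at h1
  have hsub : F ⊆ G.closedNbhd F := G.subset_closedNbhd F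
  set N := G.closedNbhd F
  have hdeg : ∀ z, ∑ v ∈ N, G.w z v ≤ G.m z := fun z => by
    have h := G.sum_w_mul_le_of_tsum_le (fun y => sq_nonneg (ρ z y)) (hρ.intrinsic z) N
    refine le_trans (le_of_eq (Finset.sum_congr rfl fun v _ => ?_)) h
    by_cases hzv : G.graph.Adj z v
    · rw [hd, G.combDist_of_adj hzv]
      ring
    · simp [G.w_eq_zero z v hzv]
  -- Here $f$ is the indicator of $\{x,y\}$. Expanding the square bounds its energy by
  -- $m_x+m_y-2w_{xy}$, strictly below its squared norm $m_x+m_y$.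
  have hE : ∑ u ∈ N, ∑ v ∈ N, G.w u v * (f u - f v) ^ 2 =
      2 * ∑ u ∈ N, f u ^ 2 * ∑ v ∈ N, G.w u v - 2 * ∑ u ∈ N, f u * ∑ v ∈ N, G.w u v * f v := by
    have h2 : ∑ u ∈ N, ∑ v ∈ N, G.w u v * f v ^ 2 = ∑ u ∈ N, f u ^ 2 * ∑ v ∈ N, G.w u v := by
      rw [Finset.sum_comm]
      refine Finset.sum_congr rfl fun u _ => ?_
      rw [Finset.mul_sum]
      exact Finset.sum_congr rfl fun v _ => by rw [G.w_symm]; ring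
    rw [two_mul, ← h2]
    nth_rewrite 2 [h2]
    simp only [Finset.mul_sum, ← Finset.sum_add_distrib, ← Finset.sum_sub_distrib]
    exact Finset.sum_congr rfl fun u _ => Finset.sum_congr rfl fun v _ => by ring
  have hs1 : ∑ u ∈ N, f u ^ 2 * ∑ v ∈ N, G.w u v ≤ G.m x + G.m y := by
    rw [← Finset.sum_subset hsub fun u _ hu => by simp [hf0 u hu], hF, Finset.sum_pair hne, hfx,
      hfy]
    linarith [hdeg x, hdeg y]
  have hs2 : 2 * G.w x y ≤ ∑ u ∈ N, f u * ∑ v ∈ N, G.w u v * f v := by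
    rw [← Finset.sum_subset hsub fun u _ hu => by simp [hf0 u hu], hF, Finset.sum_pair hne, hfx,
      hfy, ← Finset.sum_subset hsub fun u _ hu => by simp [hf0 u hu],
      ← Finset.sum_subset hsub fun u _ hu => by simp [hf0 u hu], hF, Finset.sum_pair hne,
      Finset.sum_pair hne, hfx, hfy, G.w_self, G.w_self, G.w_symm y x]
    linarith
  have hw := G.w_pos x y hxy
  have hm := add_pos (G.m_pos x) (G.m_pos y)
  by_contra! h
  nlinarith

end EdgeEstimate

/-! ### Finite boundary and connectedness of ends -/

section Ends

variable {V : Type*} {G : WeightedGraph V} {P : Set V}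

theorem IsEnd.infinite (hP : G.IsEnd P) : P.Infinite := by
  obtain ⟨_, _, _, h⟩ := hP
  exact h

theorem IsEnd.finite_boundary (hP : G.IsEnd P) : (G.boundary P).Finite := by
  obtain ⟨Ω, hΩ, ⟨K, rfl⟩, _⟩ := hP
  refine hΩ.subset ?_
  rintro y ⟨hy, x, hx, hyx⟩
  by_contra hyΩ
  exact hy (SimpleGraph.ComponentCompl.mem_of_adj x y hx hyΩ hyx.symm)

/-- A property that passes between adjacent vertices of an end and holds somewhere on the end
holds everywhere on it. -/
theorem IsEnd.forall_of_adj (hP : G.IsEnd P) {p : V → Prop}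
    (hp : ∀ x ∈ P, ∀ y ∈ P, G.graph.Adj x y → p x → p y) {x y : V} (hx : x ∈ P) (hpx : p x)
    (hy : y ∈ P) : p y := by
  obtain ⟨Ω, hΩ, ⟨K, rfl⟩, _⟩ := hP
  obtain ⟨hxΩ, hx'⟩ := id hx
  obtain ⟨hyΩ, hy'⟩ := id hy
  obtain ⟨q⟩ := SimpleGraph.ConnectedComponent.exact (hx'.trans hy'.symm)
  have : ∀ (v w : ↥(Ωᶜ)) (_ : (G.graph.induce Ωᶜ).Walk v w), v.1 ∈ K.supp → p v.1 → p w.1 := by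
    intro v w q
    induction q with
    | nil => exact fun _ h => h
    | @cons u v w huv q ih =>
      intro hu hpu
      have hv : v.1 ∈ K.supp := SimpleGraph.ComponentCompl.mem_of_adj u.1 v.1 hu v.2 huv
      exact ih hv (hp u.1 hu v.1 hv huv hpu)
  exact this _ _ q hx hpx

theorem IsEnd.exists_adj (hP : G.IsEnd P) : ∃ x ∈ P, ∃ y ∈ P, G.graph.Adj x y := by
  by_contra! h
  obtain ⟨x, hx⟩ := hP.infinite.nonempty
  refine hP.infinite ((Set.finite_singleton x).subset fun y hy => ?_)
  exact hP.forall_of_adj (p := fun y => y = x) (fun u hu v hv huv => absurd huv (h u hu v hv)) hx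
    rfl hy

end Ends

/-! ### Agmon estimates: finite volume and exponential decay -/

section Agmon

variable {V : Type*} (G : WeightedGraph V)

/-- The energy of the edges between the finite set `D` and its neighbours, for a function that
vanishes on `D`. -/
noncomputable def boundaryEnergy (D : Finset V) (f : V → ℝ) : ℝ :=
  ∑ y ∈ D, ∑ x ∈ G.nbr y, G.w x y * f x ^ 2

theorem boundaryEnergy_mono {D : Finset V} {f g : V → ℝ} (h : ∀ x, f x ^ 2 ≤ g x ^ 2) :
    G.boundaryEnergy D f ≤ G.boundaryEnergy D g :=
  Finset.sum_le_sum fun y _ => Finset.sum_le_sum fun x _ =>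
    mul_le_mul_of_nonneg_left (h x) (G.w_nonneg x y)

theorem boundaryEnergy_nonneg (D : Finset V) (f : V → ℝ) : 0 ≤ G.boundaryEnergy D f :=
  Finset.sum_nonneg fun y _ => Finset.sum_nonneg fun x _ =>
    mul_nonneg (G.w_nonneg x y) (sq_nonneg _)

/-- An edge leaving $P$ ends in $\partial P\subseteq D$ and is counted in the boundary energy. Over
edges inside $P$ the intrinsic condition $\sum_y w_{xy}\rho^2\le m_x$ turns the edge bound into
$\sum Bm$. -/
theorem mu1_mul_sum_le_of_edge_bound {ρ : V → V → ℝ} (hρ : G.IsIntrinsicMetric ρ) {P : Set V}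
    {D : Finset V} (hD : ∀ y ∈ G.boundary P, y ∈ D) {f B : V → ℝ} {F : Finset V}
    (hf : ∀ x, x ∉ F → f x = 0) (hfP : ∀ x, x ∉ P → f x = 0) (hB : ∀ x, 0 ≤ B x)
    (hBF : ∀ x, x ∉ F → B x = 0)
    (h : ∀ x ∈ P, ∀ y ∈ P, G.graph.Adj x y → (f x - f y) ^ 2 ≤ ρ x y ^ 2 * (B x + B y)) :
    G.mu1 P * ∑ x ∈ F, f x ^ 2 * G.m x ≤ G.boundaryEnergy D f + ∑ x ∈ F, B x * G.m x := by
  classical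
  refine (G.mu1_mul_sum_le_energy hf hfP).trans ?_
  set N := G.closedNbhd (F ∪ D) with hN
  have hFN : F ⊆ N := Finset.subset_union_left.trans (G.subset_closedNbhd _)
  have hDN : D ⊆ N := Finset.subset_union_right.trans (G.subset_closedNbhd _)
  rw [G.energy_eq_sum (fun x hx => hf x fun hxF => hx (Finset.mem_union_left D hxF)) hN.ge]
  set β : V → V → ℝ := fun x y => if y ∈ D then G.w x y * f x ^ 2 else 0 with hβ
  have hβ0 : ∀ x y, 0 ≤ β x y := fun x y => by
    simp only [hβ]
    split_ifs
    · exact mul_nonneg (G.w_nonneg x y) (sq_nonneg _)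
    · exact le_rfl
  set c : V → V → ℝ := fun x y => B x * (G.w x y * ρ x y ^ 2) + β x y with hc
  have hedge : ∀ x y, G.w x y * (f x - f y) ^ 2 ≤ c x y + c y x := by
    have half : ∀ x y, x ∈ P → y ∉ P → G.graph.Adj x y →
        G.w x y * (f x - f y) ^ 2 = β x y := by
      intro x y hx hy hxy
      have : y ∈ D := hD y ⟨hy, x, hx, hxy.symm⟩
      simp [hβ, this, hfP y hy]
    intro x y
    have hc0 : ∀ x y, β x y ≤ c x y := fun x y => by
      simp only [hc]
      have := mul_nonneg (hB x) (mul_nonneg (G.w_nonneg x y) (sq_nonneg (ρ x y)))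
      linarith
    have h1 := hc0 x y
    have h2 := hc0 y x
    have h3 := hβ0 x y
    have h4 := hβ0 y x
    by_cases hxy : G.graph.Adj x y
    · by_cases hx : x ∈ P <;> by_cases hy : y ∈ P
      · have h5 := mul_le_mul_of_nonneg_left (h x hx y hy hxy) (G.w_nonneg x y)
        have h6 : c x y + c y x = G.w x y * (ρ x y ^ 2 * (B x + B y)) + β x y + β y x := by
          simp only [hc]
          rw [G.w_symm y x, hρ.symm y x]
          ring
        linarith
      · have := half x y hx hy hxy
        linarith
      · have := half y x hy hx hxy.symm
        rw [G.w_symm y x] at this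
        have h5 : (f x - f y) ^ 2 = (f y - f x) ^ 2 := by ring
        rw [h5]
        linarith
      · simp only [hfP x hx, hfP y hy, sub_self, ne_eq, OfNat.ofNat_ne_zero, not_false_eq_true,
          zero_pow, mul_zero]
        linarith
    · rw [G.w_eq_zero x y hxy, zero_mul]
      linarith
  have hsymm : ∑ x ∈ N, ∑ y ∈ N, (c x y + c y x) = 2 * ∑ x ∈ N, ∑ y ∈ N, c x y := by
    simp only [Finset.sum_add_distrib]
    rw [two_mul]
    congr 1
    exact Finset.sum_comm
  have h1 : 1 / 2 * ∑ x ∈ N, ∑ y ∈ N, G.w x y * (f x - f y) ^ 2 ≤ ∑ x ∈ N, ∑ y ∈ N, c x y := by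
    have : ∑ x ∈ N, ∑ y ∈ N, G.w x y * (f x - f y) ^ 2 ≤ ∑ x ∈ N, ∑ y ∈ N, (c x y + c y x) :=
      Finset.sum_le_sum fun x _ => Finset.sum_le_sum fun y _ => hedge x y
    linarith
  have h2 : ∑ x ∈ N, ∑ y ∈ N, β x y = G.boundaryEnergy D f := by
    rw [Finset.sum_comm, boundaryEnergy, ← Finset.sum_subset hDN]
    · refine Finset.sum_congr rfl fun y hy => ?_
      rw [← Finset.sum_subset
        (G.nbr_subset_closedNbhd (Finset.mem_union_right F hy) : G.nbr y ⊆ N)]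
      · exact Finset.sum_congr rfl fun x _ => by simp [hβ, hy]
      · intro x _ hx
        have : ¬ G.graph.Adj x y := fun hxy => hx (G.mem_nbr.2 hxy.symm)
        simp [hβ, G.w_eq_zero x y this]
    · intro y _ hy
      simp [hβ, hy]
  have h3 : ∑ x ∈ N, ∑ y ∈ N, B x * (G.w x y * ρ x y ^ 2) ≤ ∑ x ∈ F, B x * G.m x := by
    rw [Finset.sum_subset hFN fun x _ hx => by simp [hBF x hx]]
    refine Finset.sum_le_sum fun x _ => ?_
    rw [← Finset.mul_sum]
    exact mul_le_mul_of_nonneg_left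
      (G.sum_w_mul_le_of_tsum_le (fun y => sq_nonneg (ρ x y)) (hρ.intrinsic x) N) (hB x)
  refine h1.trans ?_
  simp only [hc, Finset.sum_add_distrib]
  linarith

/-- An Agmon type estimate for the weight `e^{a g}`, where `g` is locally constant off `A` and a
cutoff is made in the annulus `T ≤ r ≤ T + 3s`. -/
theorem agmon_estimate {ρ : V → V → ℝ} (hρ : G.IsAdmissibleMetric ρ) {P : Set V}
    (hs : 0 < G.jumpSize ρ) (hμ : 0 < G.mu1 P) {a : ℝ}
    (hexp : ∀ x y, G.graph.Adj x y → ∀ p q : ℝ, |p - q| ≤ ρ x y →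
      (Real.exp (a * p) - Real.exp (a * q)) ^ 2 ≤
        G.mu1 P * ρ x y ^ 2 * (Real.exp (a * p) ^ 2 + Real.exp (a * q) ^ 2))
    (x₀ : V) {D : Finset V} (hD : ∀ y ∈ G.boundary P, y ∈ D) {g : V → ℝ}
    (hg : ∀ x y, |g x - g y| ≤ ρ x y) {A : Set V}
    (hA : ∀ x y, G.graph.Adj x y → x ∉ A → g y = g x) {T : ℝ} {F N : Finset V}
    (hF : ∀ x ∈ F, x ∈ P ∧ ρ x x₀ < T ∧ x ∉ A)
    (hN : ∀ x ∈ P, T ≤ ρ x x₀ → ρ x x₀ ≤ T + 3 * G.jumpSize ρ → x ∈ N) :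
    G.mu1 P * ∑ x ∈ F, Real.exp (a * g x) ^ 2 * G.m x ≤
      G.boundaryEnergy D (fun x => Real.exp (a * g x)) +
        (2 * G.mu1 P + 2 / G.jumpSize ρ ^ 2) * ∑ x ∈ N, Real.exp (a * g x) ^ 2 * G.m x := by
  classical
  set μ := G.mu1 P
  set s := G.jumpSize ρ with hsdef
  set C := 2 * μ + 2 / s ^ 2 with hC
  have hCμ : μ ≤ C := by
    have : 0 ≤ 2 / s ^ 2 := by positivity
    linarith
  set ψ : V → ℝ := fun x => Real.exp (a * g x) with hψ
  have hψ0 : ∀ x, 0 < ψ x := fun x => Real.exp_pos _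
  -- The cutoff falls from $1$ to $0$ between radii $T+s$ and $T+2s$. The margin of one jump on each
  -- side forces every edge on which it changes to have both ends in the annulus $[T,T+3s]$.
  set η : V → ℝ := fun x => max 0 (min 1 ((T + 2 * s - ρ x x₀) / s)) with hη
  have hη0 : ∀ x, 0 ≤ η x := fun x => le_max_left _ _
  have hη1 : ∀ x, η x ≤ 1 := fun x => max_le zero_le_one (min_le_left _ _)
  have hηone : ∀ x, ρ x x₀ ≤ T + s → η x = 1 := fun x hx => by
    have : 1 ≤ (T + 2 * s - ρ x x₀) / s := by
      rw [le_div_iff₀ hs]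
      linarith
    simp [hη, min_eq_left this]
  have hηzero : ∀ x, T + 2 * s ≤ ρ x x₀ → η x = 0 := fun x hx => by
    have : (T + 2 * s - ρ x x₀) / s ≤ 0 := div_nonpos_of_nonpos_of_nonneg (by linarith) hs.le
    exact max_eq_left ((min_le_right _ _).trans this)
  have hηlip : ∀ x y, |η x - η y| ≤ ρ x y / s := fun x y => by
    have h1 := abs_max_sub_max_le_max 0 (min 1 ((T + 2 * s - ρ x x₀) / s)) 0
      (min 1 ((T + 2 * s - ρ y x₀) / s))
    have h2 := abs_min_sub_min_le_max 1 ((T + 2 * s - ρ x x₀) / s) 1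
      ((T + 2 * s - ρ y x₀) / s)
    have hmax : ∀ t : ℝ, max 0 |t| = |t| := fun t => max_eq_right (abs_nonneg t)
    rw [sub_self, abs_zero, hmax] at h1 h2
    refine h1.trans (h2.trans ?_)
    rw [← sub_div, abs_div, abs_of_pos hs, abs_sub_comm]
    gcongr
    calc _ = |ρ x x₀ - ρ y x₀| := by ring_nf
      _ ≤ ρ x y := hρ.isIntrinsicMetric.abs_sub_le x₀ x y
  set f : V → ℝ := fun x => if x ∈ P then η x * ψ x else 0 with hf
  have hfin := (hρ.finite_le x₀ (T + 3 * s))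
  set F' : Finset V := hfin.toFinset with hF'
  have hmemF' : ∀ x, x ∈ F' ↔ ρ x x₀ ≤ T + 3 * s := fun x => by simp [hF']
  -- In the annulus, $(p+q)^2\le2p^2+2q^2$ gives the constant $C=2\mu+2/s^2$. Below it, $\mu\psi^2$
  -- suffices on $A$, and an edge with an end off $A$ costs nothing because $g$ takes equal values
  -- at its ends.
  set B : V → ℝ := fun x => if x ∈ P ∧ ρ x x₀ ≤ T + 3 * s then
    (if T ≤ ρ x x₀ then C * ψ x ^ 2 else if x ∈ A then μ * ψ x ^ 2 else 0) else 0 with hB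
  have hBnn : ∀ x, 0 ≤ B x := fun x => by
    simp only [hB]
    split_ifs <;> positivity
  have hf0 : ∀ x, x ∉ F' → f x = 0 := fun x hx => by
    rw [hmemF', not_le] at hx
    simp [hf, hηzero x (by linarith)]
  have hB0 : ∀ x, x ∉ F' → B x = 0 := fun x hx => by
    rw [hmemF'] at hx
    simp [hB, hx]
  have hfP : ∀ x, x ∉ P → f x = 0 := fun x hx => by simp [hf, hx]
  have hψe : ∀ x y, G.graph.Adj x y → (ψ x - ψ y) ^ 2 ≤ μ * ρ x y ^ 2 * (ψ x ^ 2 + ψ y ^ 2) :=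
    fun x y hxy => hexp x y hxy _ _ (hg x y)
  have hedge : ∀ x ∈ P, ∀ y ∈ P, G.graph.Adj x y → ρ x x₀ ≤ ρ y x₀ →
      (f x - f y) ^ 2 ≤ ρ x y ^ 2 * (B x + B y) := by
    intro x hx y hy hxy hle
    have hj : ρ x y ≤ s := hρ.le_jumpSize hxy
    have hr := abs_le.1 (hρ.isIntrinsicMetric.abs_sub_le x₀ x y)
    have hfx : f x = η x * ψ x := by simp [hf, hx]
    have hfy : f y = η y * ψ y := by simp [hf, hy]
    have hnn : 0 ≤ ρ x y ^ 2 * (B x + B y) :=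
      mul_nonneg (sq_nonneg _) (add_nonneg (hBnn x) (hBnn y))
    have h1 := hψe x y hxy
    rcases lt_or_ge (T + 3 * s) (ρ y x₀) with hy3 | hy3
    · rw [hfx, hfy, hηzero x (by linarith), hηzero y (by linarith)]
      simpa using hnn
    rcases le_or_gt T (ρ x x₀) with hxT | hxT
    · have hBx : B x = C * ψ x ^ 2 := by
        simp [hB, hx, hxT, show ρ x x₀ ≤ T + 3 * s by linarith]
      have hBy : B y = C * ψ y ^ 2 := by
        simp [hB, hy, hy3, show T ≤ ρ y x₀ by linarith]
      have h2 : (η x - η y) ^ 2 ≤ ρ x y ^ 2 / s ^ 2 := by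
        rw [← div_pow, ← sq_abs]
        exact pow_le_pow_left₀ (abs_nonneg _) (hηlip x y) 2
      have h3 : η x ^ 2 ≤ 1 := pow_le_one₀ (hη0 x) (hη1 x)
      rw [hfx, hfy, hBx, hBy]
      calc (η x * ψ x - η y * ψ y) ^ 2
          = (η x * (ψ x - ψ y) + ψ y * (η x - η y)) ^ 2 := by ring
        _ ≤ 2 * ((η x * (ψ x - ψ y)) ^ 2 + (ψ y * (η x - η y)) ^ 2) := add_sq_le
        _ = 2 * (η x ^ 2 * (ψ x - ψ y) ^ 2 + ψ y ^ 2 * (η x - η y) ^ 2) := by ring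
        _ ≤ 2 * (1 * (μ * ρ x y ^ 2 * (ψ x ^ 2 + ψ y ^ 2)) +
            ψ y ^ 2 * (ρ x y ^ 2 / s ^ 2)) := by gcongr
        _ ≤ 2 * (1 * (μ * ρ x y ^ 2 * (ψ x ^ 2 + ψ y ^ 2)) +
            (ψ x ^ 2 + ψ y ^ 2) * (ρ x y ^ 2 / s ^ 2)) := by
          gcongr
          linarith [sq_nonneg (ψ x)]
        _ = ρ x y ^ 2 * (C * ψ x ^ 2 + C * ψ y ^ 2) := by
          rw [hC]
          ring
    · rw [hfx, hfy, hηone x (by linarith), hηone y (by linarith), one_mul, one_mul]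
      by_cases hxA : x ∈ A
      · have hBx : B x = μ * ψ x ^ 2 := by
          simp [hB, hx, hxA, not_le.2 hxT, show ρ x x₀ ≤ T + 3 * s by linarith]
        by_cases hyA : y ∈ A
        · have hBy : μ * ψ y ^ 2 ≤ B y := by
            simp only [hB, hy, hy3, and_self, if_true, hyA]
            split_ifs
            · gcongr
            · exact le_rfl
          calc _ ≤ _ := h1
            _ = ρ x y ^ 2 * (μ * ψ x ^ 2 + μ * ψ y ^ 2) := by ring
            _ ≤ _ := by
              rw [hBx]
              gcongr
        · simpa [hψ, hA y x hxy.symm hyA] using hnn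
      · simpa [hψ, hA x y hxy hxA] using hnn
  have main := G.mu1_mul_sum_le_of_edge_bound hρ.isIntrinsicMetric hD hf0 hfP hBnn hB0
    (fun x hx y hy hxy => by
      rcases le_total (ρ x x₀) (ρ y x₀) with h | h
      · exact hedge x hx y hy hxy h
      · have := hedge y hy x hx hxy.symm h
        rw [hρ.isIntrinsicMetric.symm y x] at this
        linarith [sq_nonneg (f x - f y)])
  have hbd : G.boundaryEnergy D f ≤ G.boundaryEnergy D ψ := by
    refine G.boundaryEnergy_mono fun x => ?_
    simp only [hf]
    split_ifs
    · rw [mul_pow]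
      exact mul_le_of_le_one_left (sq_nonneg _) (pow_le_one₀ (hη0 x) (hη1 x))
    · rw [zero_pow two_ne_zero]
      exact sq_nonneg _
  -- Absorption: below radius $T$ and on $A$, the term $Bm\le\mu\psi^2m$ is no larger than $\mu
  -- f^2m$. Points of $F$ have $B=0$ and keep their full weight.
  have hpt : ∀ x, (if x ∈ F then μ * (ψ x ^ 2 * G.m x) else 0) ≤
      μ * (f x ^ 2 * G.m x) - B x * G.m x + if x ∈ N then C * (ψ x ^ 2 * G.m x) else 0 := by
    intro x
    have hm := G.m_pos x
    have hμf : 0 ≤ μ * (f x ^ 2 * G.m x) := by positivity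
    have hlast : 0 ≤ if x ∈ N then C * (ψ x ^ 2 * G.m x) else 0 := by
      split_ifs <;> positivity
    by_cases hxF : x ∈ F
    · obtain ⟨hxP, hxT, hxA⟩ := hF x hxF
      have hBx : B x = 0 := by simp [hB, hxA, not_le.2 hxT]
      have hfx : f x = ψ x := by simp [hf, hxP, hηone x (by linarith)]
      rw [if_pos hxF, hBx, hfx]
      linarith
    · rw [if_neg hxF]
      by_cases hxP : x ∈ P ∧ ρ x x₀ ≤ T + 3 * s
      · rcases le_or_gt T (ρ x x₀) with hxT | hxT
        · have hBx : B x = C * ψ x ^ 2 := by simp [hB, hxP, hxT]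
          rw [if_pos (hN x hxP.1 hxT hxP.2), hBx]
          linarith
        · have hBx : B x ≤ μ * ψ x ^ 2 := by
            simp only [hB, hxP, and_self, if_true, not_le.2 hxT, if_false]
            split_ifs
            · exact le_rfl
            · positivity
          have hfx : f x = ψ x := by simp [hf, hxP.1, hηone x (by linarith)]
          rw [hfx]
          nlinarith
      · have hBx : B x = 0 := by simp only [hB, hxP, if_false]
        rw [hBx]
        linarith
  have hsum := Finset.sum_le_sum fun x (_ : x ∈ F') => hpt x
  rw [Finset.sum_add_distrib, Finset.sum_sub_distrib, ← Finset.sum_filter, ← Finset.sum_filter,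
    ← Finset.mul_sum, ← Finset.mul_sum, ← Finset.mul_sum] at hsum
  have hFF : F'.filter (· ∈ F) = F := by
    ext x
    simp only [Finset.mem_filter, and_iff_right_iff_imp]
    intro hx
    rw [hmemF']
    linarith [(hF x hx).2.1]
  have hNN : ∑ x ∈ F'.filter (· ∈ N), ψ x ^ 2 * G.m x ≤ ∑ x ∈ N, ψ x ^ 2 * G.m x :=
    Finset.sum_le_sum_of_subset_of_nonneg (fun x hx => (Finset.mem_filter.1 hx).2)
      fun x _ _ => mul_nonneg (sq_nonneg _) (G.m_pos x).le
  rw [hFF] at hsum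
  have hC0 : 0 ≤ C := by linarith
  have := mul_le_mul_of_nonneg_left hNN hC0
  linarith

theorem exists_forall_le (r : V → ℝ) (F : Finset V) : ∃ M : ℝ, ∀ x ∈ F, r x ≤ M := by
  obtain ⟨M, hM⟩ := (F.finite_toSet.image r).bddAbove
  exact ⟨M, fun x hx => hM ⟨x, hx, rfl⟩⟩

theorem IsAdmissibleMetric.exists_mem_iff_annulusPart {G : WeightedGraph V} {ρ : V → V → ℝ}
    (hρ : G.IsAdmissibleMetric ρ) (x₀ : V) (P : Set V) (R₁ R₂ : ℝ) :
    ∃ N : Finset V, ∀ x, x ∈ N ↔ x ∈ annulusPart ρ x₀ P R₁ R₂ :=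
  ⟨((hρ.finite_le x₀ R₂).subset fun _ hx => hx.2.2 :
    (annulusPart ρ x₀ P R₁ R₂).Finite).toFinset, by simp⟩

/-- If the weighted annulus sums tend to zero along a sequence, the volume is finite. -/
theorem vol_lt_top_of_tendsto {ρ : V → V → ℝ} (hρ : G.IsAdmissibleMetric ρ) {P : Set V}
    (hs : 0 < G.jumpSize ρ) (hμ : 0 < G.mu1 P) {a : ℝ} (ha : 0 < a)
    (hexp : ∀ x y, G.graph.Adj x y → ∀ p q : ℝ, |p - q| ≤ ρ x y →
      (Real.exp (a * p) - Real.exp (a * q)) ^ 2 ≤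
        G.mu1 P * ρ x y ^ 2 * (Real.exp (a * p) ^ 2 + Real.exp (a * q) ^ 2))
    (x₀ : V) (hfin : (G.boundary P).Finite) {R : ℕ → ℝ} (hR : Tendsto R atTop atTop)
    (hlim : Tendsto (fun i => ∑' x : annulusPart ρ x₀ P (R i) (R i + 3 * G.jumpSize ρ),
      ENNReal.ofReal (Real.exp (-2 * a * ρ x x₀) * G.m x)) atTop (𝓝 0)) :
    G.vol P < ∞ := by
  set s := G.jumpSize ρ with hsdef
  choose N hN using fun i => hρ.exists_mem_iff_annulusPart x₀ P (R i) (R i + 3 * s)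
  have hlim' : Tendsto (fun i => ∑ x ∈ N i, Real.exp (-2 * a * ρ x x₀) * G.m x) atTop (𝓝 0) := by
    have h := (ENNReal.tendsto_toReal ENNReal.zero_ne_top).comp hlim
    rw [ENNReal.toReal_zero] at h
    refine h.congr fun i => ?_
    have hnn : ∀ x, 0 ≤ Real.exp (-2 * a * ρ x x₀) * G.m x := fun x =>
      mul_nonneg (Real.exp_pos _).le (G.m_pos x).le
    rw [Function.comp_apply, tsum_subtype_ofReal_eq _ hnn (N i) (hN i),
      ENNReal.toReal_ofReal (Finset.sum_nonneg fun x _ => hnn x)]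
  set D := hfin.toFinset with hD
  set K := G.boundaryEnergy D fun _ => 1 with hK
  refine (G.vol_le_of_forall_sum_le (c := K / G.mu1 P) fun F hF => ?_).trans_lt
    ENNReal.ofReal_lt_top
  obtain ⟨M, hM⟩ := exists_forall_le (fun x => ρ x x₀) F
  set R' := M + s + 1 with hR'
  -- The weight is $1$ on $F$ and its square decays like $e^{-2ar}$ beyond $R'$. The boundary bound
  -- $K$ does not depend on $F$, so letting $i\to\infty$ bounds all finite partial sums of the
  -- volume by $K/\mu$.
  set g : V → ℝ := fun x => -max (ρ x x₀ - R') 0 with hg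
  have hg0 : ∀ x, ρ x x₀ ≤ R' → g x = 0 := fun x hx => by
    simp [hg, max_eq_right (sub_nonpos.2 hx)]
  have hglip : ∀ x y, |g x - g y| ≤ ρ x y := fun x y => by
    have h := abs_max_sub_max_le_abs (ρ x x₀ - R') (ρ y x₀ - R') 0
    have h2 := hρ.isIntrinsicMetric.abs_sub_le x₀ x y
    rw [sub_sub_sub_cancel_right] at h
    rw [show g x - g y = -(max (ρ x x₀ - R') 0 - max (ρ y x₀ - R') 0) by simp only [hg]; ring,
      abs_neg]
    exact h.trans h2
  rw [le_div_iff₀' hμ]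
  have hlim2 := ((hlim'.const_mul (Real.exp (2 * a * R'))).const_mul
    (2 * G.mu1 P + 2 / s ^ 2)).const_add K
  simp only [mul_zero, add_zero] at hlim2
  refine ge_of_tendsto hlim2 ?_
  filter_upwards [hR.eventually_ge_atTop R'] with i hi
  have h := G.agmon_estimate hρ hs hμ hexp x₀ (D := D) (fun y hy => by simpa [hD] using hy)
    hglip (A := {x | R' - s ≤ ρ x x₀}) (fun x y hxy hx => by
      simp only [Set.mem_ofPred_eq, not_le] at hx
      have h1 := hρ.le_jumpSize hxy
      have h2 := abs_le.1 (hρ.isIntrinsicMetric.abs_sub_le x₀ x y)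
      rw [hg0 x (by linarith), hg0 y (by linarith)]) (T := R i) (F := F) (N := N i)
    (fun x hx => by
      have := hM x hx
      exact ⟨hF x hx, by linarith, by simp only [Set.mem_ofPred_eq, not_le]; linarith⟩)
    (fun x hx h1 h2 => (hN i x).2 ⟨hx, h1, h2⟩)
  have h1 : ∑ x ∈ F, Real.exp (a * g x) ^ 2 * G.m x = ∑ x ∈ F, G.m x :=
    Finset.sum_congr rfl fun x hx => by
      rw [hg0 x (by linarith [hM x hx])]
      simp
  have h2 : ∑ x ∈ N i, Real.exp (a * g x) ^ 2 * G.m x ≤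
      Real.exp (2 * a * R') * ∑ x ∈ N i, Real.exp (-2 * a * ρ x x₀) * G.m x := by
    rw [Finset.mul_sum]
    refine Finset.sum_le_sum fun x hx => ?_
    have hx' := ((hN i x).1 hx).2.1
    rw [← mul_assoc, ← Real.exp_add, ← Real.exp_nat_mul]
    refine le_of_eq ?_
    congr 2
    simp only [hg, max_eq_left (show 0 ≤ ρ x x₀ - R' by linarith)]
    push_cast
    ring
  have h3 : G.boundaryEnergy D (fun x => Real.exp (a * g x)) ≤ K := by
    refine G.boundaryEnergy_mono fun x => ?_
    rw [one_pow]
    refine pow_le_one₀ (Real.exp_pos _).le (Real.exp_le_one_iff.2 ?_)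
    exact mul_nonpos_of_nonneg_of_nonpos ha.le (neg_nonpos.2 (le_max_right _ _))
  rw [h1] at h
  have : (2 * G.mu1 P + 2 / s ^ 2) * ∑ x ∈ N i, Real.exp (a * g x) ^ 2 * G.m x ≤ _ :=
    mul_le_mul_of_nonneg_left h2 (by positivity)
  linarith

theorem exists_lt_sum {Ω : Set V} {ε : ℝ} (hε : 0 < ε) :
    ∃ F : Finset V, (∀ x ∈ F, x ∈ Ω) ∧ (G.vol Ω).toReal - ε < ∑ x ∈ F, G.m x := by
  by_contra! h
  have h0 := h ∅ (by simp)
  rw [Finset.sum_empty] at h0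
  have h1 := ENNReal.toReal_mono ENNReal.ofReal_ne_top (G.vol_le_of_forall_sum_le h)
  rw [ENNReal.toReal_ofReal h0] at h1
  linarith

/-- If the volume is finite, it decays exponentially with the sharp rate. -/
theorem exists_vol_tail_le {ρ : V → V → ℝ} (hρ : G.IsAdmissibleMetric ρ) {P : Set V}
    (hs : 0 < G.jumpSize ρ) (hμ : 0 < G.mu1 P) {a : ℝ} (ha : 0 < a)
    (hexp : ∀ x y, G.graph.Adj x y → ∀ p q : ℝ, |p - q| ≤ ρ x y →
      (Real.exp (a * p) - Real.exp (a * q)) ^ 2 ≤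
        G.mu1 P * ρ x y ^ 2 * (Real.exp (a * p) ^ 2 + Real.exp (a * q) ^ 2))
    (x₀ : V) (hfin : (G.boundary P).Finite) (hvol : G.vol P < ∞) :
    ∃ C : ℝ, 0 < C ∧ ∀ R : ℝ,
      G.vol {x ∈ P | R ≤ ρ x x₀} ≤ ENNReal.ofReal (C * Real.exp (-2 * a * R)) := by
  set s := G.jumpSize ρ with hsdef
  set D := hfin.toFinset with hD
  set K := G.boundaryEnergy D fun x => Real.exp (a * ρ x x₀) with hK
  have hK0 : 0 ≤ K := G.boundaryEnergy_nonneg _ _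
  refine ⟨(K + 1) / G.mu1 P * Real.exp (4 * a * s), by positivity, fun R => ?_⟩
  refine G.vol_le_of_forall_sum_le fun F hF => ?_
  -- Stopping the growth two jumps early makes $F$ avoid $A=\{r\le R'+s\}$; this costs the factor
  -- $e^{4as}$.
  set R' := R - 2 * s with hR'
  have hE : Real.exp (4 * a * s) * Real.exp (-2 * a * R) = (Real.exp (a * R') ^ 2)⁻¹ := by
    rw [← Real.exp_add, ← Real.exp_nat_mul, ← Real.exp_neg]
    congr 1
    rw [hR']
    push_cast
    ring
  rw [mul_assoc, hE, ← div_eq_mul_inv, le_div_iff₀ (by positivity), le_div_iff₀ hμ]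
  set C := (2 * G.mu1 P + 2 / s ^ 2) * Real.exp (a * R') ^ 2 with hC
  have hC0 : 0 < C := by positivity
  -- $F_1$ carries all but $1/C$ of the volume. An annulus beyond it has volume at most $1/C$, so
  -- the cutoff error is at most $1$, whence the $K+1$ in the constant.
  obtain ⟨F₁, hF₁, hF₁'⟩ := G.exists_lt_sum (Ω := P) (ε := 1 / C) (by positivity)
  classical
  obtain ⟨M, hM⟩ := exists_forall_le (fun x => ρ x x₀) (F ∪ F₁)
  obtain ⟨N, hN⟩ := hρ.exists_mem_iff_annulusPart x₀ P (M + 1) (M + 1 + 3 * s)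
  set g : V → ℝ := fun x => min (ρ x x₀) R' with hg
  have hgR : ∀ x, R' ≤ ρ x x₀ → g x = R' := fun x hx => min_eq_right hx
  have hglip : ∀ x y, |g x - g y| ≤ ρ x y := fun x y => by
    have h := abs_min_sub_min_le_max (ρ x x₀) R' (ρ y x₀) R'
    rw [sub_self, abs_zero, max_eq_left (abs_nonneg _)] at h
    exact h.trans (hρ.isIntrinsicMetric.abs_sub_le x₀ x y)
  have h := G.agmon_estimate hρ hs hμ hexp x₀ (D := D) (fun y hy => by simpa [hD] using hy)
    hglip (A := {x | ρ x x₀ ≤ R' + s}) (fun x y hxy hx => by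
      simp only [Set.mem_ofPred_eq, not_le] at hx
      have h1 := hρ.le_jumpSize hxy
      have h2 := abs_le.1 (hρ.isIntrinsicMetric.abs_sub_le x₀ x y)
      rw [hgR x (by linarith), hgR y (by linarith)]) (T := M + 1) (F := F) (N := N)
    (fun x hx => by
      have h1 := hM x (Finset.mem_union_left _ hx)
      have h2 := (hF x hx).2
      exact ⟨(hF x hx).1, by linarith, by simp only [Set.mem_ofPred_eq, not_le]; linarith⟩)
    (fun x hx h1 h2 => (hN x).2 ⟨hx, h1, h2⟩)
  have h1 : ∑ x ∈ F, Real.exp (a * g x) ^ 2 * G.m x =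
      Real.exp (a * R') ^ 2 * ∑ x ∈ F, G.m x := by
    rw [Finset.mul_sum]
    refine Finset.sum_congr rfl fun x hx => ?_
    rw [hgR x (by linarith [(hF x hx).2])]
  have h2 : ∑ x ∈ N, Real.exp (a * g x) ^ 2 * G.m x ≤
      Real.exp (a * R') ^ 2 * ∑ x ∈ N, G.m x := by
    rw [Finset.mul_sum]
    refine Finset.sum_le_sum fun x hx => ?_
    have := G.m_pos x
    have : g x ≤ R' := min_le_right _ _
    gcongr
  have h3 : G.boundaryEnergy D (fun x => Real.exp (a * g x)) ≤ K := by
    refine G.boundaryEnergy_mono fun x => ?_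
    have : g x ≤ ρ x x₀ := min_le_left _ _
    gcongr
  have h4 : ∑ x ∈ N, G.m x ≤ 1 / C := by
    have hdisj : Disjoint F₁ N := Finset.disjoint_left.2 fun x hx hxN => by
      have h5 := hM x (Finset.mem_union_right _ hx)
      have h6 := ((hN x).1 hxN).2.1
      linarith
    have h5 := G.sum_le_toReal_vol hvol (F := F₁ ∪ N) fun x hx => by
      rcases Finset.mem_union.1 hx with hx | hx
      · exact hF₁ x hx
      · exact ((hN x).1 hx).1
    rw [Finset.sum_union hdisj] at h5
    linarith
  rw [h1] at h
  have h5 : (2 * G.mu1 P + 2 / s ^ 2) * ∑ x ∈ N, Real.exp (a * g x) ^ 2 * G.m x ≤ 1 :=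
    calc _ ≤ (2 * G.mu1 P + 2 / s ^ 2) * (Real.exp (a * R') ^ 2 * ∑ x ∈ N, G.m x) := by gcongr
      _ = C * ∑ x ∈ N, G.m x := by rw [hC]; ring
      _ ≤ C * (1 / C) := by gcongr
      _ = 1 := by field_simp
  linarith

end Agmon

/-! ### Finite volume implies parabolicity -/

section Caccioppoli

variable {V : Type*} (G : WeightedGraph V)

/-- Caccioppoli's inequality for a nonnegative function that is subharmonic on the support of the
cutoff function. -/
theorem energy_mul_le {φ v : V → ℝ} {F N : Finset V} (hφ : ∀ x, x ∉ F → φ x = 0)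
    (hv : ∀ x, 0 ≤ v x) (hsub : ∀ x, φ x ≠ 0 → v x ≠ 0 → 0 ≤ ∑ y ∈ N, G.w x y * (v y - v x))
    (hN : G.closedNbhd F ⊆ N) :
    G.energy (fun x => φ x * v x) ≤
      1 / 2 * ∑ x ∈ N, ∑ y ∈ N, G.w x y * (v x * v y * (φ x - φ y) ^ 2) := by
  rw [G.energy_eq_sum (F := F) (fun x hx => by simp [hφ x hx]) hN]
  set c : V → V → ℝ := fun x y => G.w x y * (φ x ^ 2 * v x * (v x - v y)) with hc
  -- Discrete product rule: the last two terms, after summation, are minus a weighted sum of $\Delta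
  -- v$ against $\varphi^2v\ge0$.
  have h1 : ∀ x y, G.w x y * (φ x * v x - φ y * v y) ^ 2 =
      G.w x y * (v x * v y * (φ x - φ y) ^ 2) + (c x y + c y x) := fun x y => by
    simp only [hc]
    rw [G.w_symm y x]
    ring
  have h2 : ∑ x ∈ N, ∑ y ∈ N, c y x = ∑ x ∈ N, ∑ y ∈ N, c x y := Finset.sum_comm
  have h3 : ∑ x ∈ N, ∑ y ∈ N, c x y ≤ 0 := by
    refine Finset.sum_nonpos fun x _ => ?_
    have h4 : ∑ y ∈ N, c x y = -(φ x ^ 2 * v x * ∑ y ∈ N, G.w x y * (v y - v x)) := by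
      rw [Finset.mul_sum, ← Finset.sum_neg_distrib]
      exact Finset.sum_congr rfl fun y _ => by simp only [hc]; ring
    rw [h4, neg_nonpos]
    by_cases hφx : φ x = 0
    · simp [hφx]
    by_cases hvx : v x = 0
    · simp [hvx]
    exact mul_nonneg (mul_nonneg (sq_nonneg _) (hv x)) (hsub x hφx hvx)
  simp only [h1, Finset.sum_add_distrib]
  linarith

/-- On a set of finite volume with positive bottom of the spectrum, a nonnegative bounded function
that vanishes off the set and is subharmonic on it is zero. -/
theorem eq_zero_of_subharmonic {ρ : V → V → ℝ} (hρ : G.IsAdmissibleMetric ρ) {P : Set V}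
    (hμ : 0 < G.mu1 P) (x₀ : V) (hvol : G.vol P < ∞) {v : V → ℝ} (hv : ∀ x, 0 ≤ v x)
    (hv1 : ∀ x, v x ≤ 1) (hvP : ∀ x, x ∉ P → v x = 0)
    (hsub : ∀ x ∈ P, v x ≠ 0 → ∀ N : Finset V, G.nbr x ⊆ N →
      0 ≤ ∑ y ∈ N, G.w x y * (v y - v x)) (x : V) : v x = 0 := by
  classical
  by_contra hvx
  set M := (G.vol P).toReal with hM
  have hρx : 0 ≤ ρ x x₀ := hρ.isIntrinsicMetric.nonneg _ _
  have key : ∀ k : ℝ, 2 * ρ x x₀ + 1 ≤ k →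
      G.mu1 P * (v x ^ 2 * G.m x) * k ^ 2 ≤ 2 * M := by
    intro k hk
    have hk0 : 0 < k := by linarith
    set φ : V → ℝ := fun y => max 0 (1 - ρ y x₀ / k) with hφ
    set F := (hρ.finite_le x₀ k).toFinset with hF
    have hφF : ∀ y, y ∉ F → φ y = 0 := fun y hy => by
      have hy' : k < ρ y x₀ := by simpa [hF] using hy
      refine max_eq_left (sub_nonpos.2 ?_)
      rw [le_div_iff₀ hk0]
      linarith
    have hφlip : ∀ y z, (φ y - φ z) ^ 2 ≤ ρ y z ^ 2 / k ^ 2 := fun y z => by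
      have h1 := abs_max_sub_max_le_max 0 (1 - ρ y x₀ / k) 0 (1 - ρ z x₀ / k)
      have hmax : ∀ t : ℝ, max 0 |t| = |t| := fun t => max_eq_right (abs_nonneg t)
      rw [sub_self, abs_zero, hmax] at h1
      rw [← div_pow, ← sq_abs]
      refine pow_le_pow_left₀ (abs_nonneg _) (h1.trans ?_) 2
      rw [sub_sub_sub_cancel_left, ← sub_div, abs_div, abs_of_pos hk0]
      gcongr
      rw [abs_sub_comm]
      exact hρ.isIntrinsicMetric.abs_sub_le x₀ y z
    have hxF : x ∈ F := by
      simp only [hF, Set.Finite.mem_toFinset, Set.mem_ofPred_eq]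
      linarith
    have hφx : 1 / 2 ≤ φ x := by
      refine le_trans ?_ (le_max_right _ _)
      have : ρ x x₀ / k ≤ 1 / 2 := by
        rw [div_le_iff₀ hk0]
        linarith
      linarith
    set N := G.closedNbhd F with hN
    have h1 := G.mu1_mul_sum_le_energy (P := P) (f := fun y => φ y * v y) (F := F)
      (fun y hy => by simp [hφF y hy]) (fun y hy => by simp [hvP y hy])
    have h2 := G.energy_mul_le (N := N) hφF hv (fun y hφy hvy => hsub y
      (by_contra fun h => hvy (hvP y h)) hvy N
      (G.nbr_subset_closedNbhd (by_contra fun h => hφy (hφF y h)))) le_rfl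
    have h3 : ∑ y ∈ N, ∑ z ∈ N, G.w y z * (v y * v z * (φ y - φ z) ^ 2) ≤ M / k ^ 2 := by
      have h4 : ∀ y ∈ N, ∑ z ∈ N, G.w y z * (v y * v z * (φ y - φ z) ^ 2) ≤
          (if y ∈ P then G.m y else 0) / k ^ 2 := by
        intro y _
        split_ifs with hy
        · calc _ ≤ ∑ z ∈ N, G.w y z * (1 * 1 * (ρ y z ^ 2 / k ^ 2)) := by
                refine Finset.sum_le_sum fun z _ => ?_
                have := G.w_nonneg y z
                have := hφlip y z
                have := hv1 y
                have := hv1 z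
                have := hv y
                have := hv z
                gcongr
            _ = (∑ z ∈ N, G.w y z * ρ y z ^ 2) / k ^ 2 := by
                rw [Finset.sum_div]
                exact Finset.sum_congr rfl fun z _ => by ring
            _ ≤ _ := by
                gcongr
                exact G.sum_w_mul_le_of_tsum_le (fun z => sq_nonneg (ρ y z))
                  (hρ.isIntrinsicMetric.intrinsic y) N
        · simp [hvP y hy]
      refine (Finset.sum_le_sum h4).trans ?_
      rw [← Finset.sum_div, ← Finset.sum_filter]
      gcongr
      exact G.sum_le_toReal_vol hvol fun y hy => (Finset.mem_filter.1 hy).2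
    have h5 : (φ x * v x) ^ 2 * G.m x ≤ ∑ y ∈ F, (φ y * v y) ^ 2 * G.m y :=
      Finset.single_le_sum (f := fun y => (φ y * v y) ^ 2 * G.m y)
        (fun y _ => mul_nonneg (sq_nonneg _) (G.m_pos y).le) hxF
    have h6 : 1 / 4 * (v x ^ 2 * G.m x) ≤ (φ x * v x) ^ 2 * G.m x := by
      have := G.m_pos x
      calc 1 / 4 * (v x ^ 2 * G.m x) = ((1 / 2) * v x) ^ 2 * G.m x := by ring
        _ ≤ _ := by
          have := hv x
          gcongr
    have h7 : G.mu1 P * (1 / 4 * (v x ^ 2 * G.m x)) ≤ 1 / 2 * (M / k ^ 2) :=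
      calc _ ≤ G.mu1 P * ∑ y ∈ F, (φ y * v y) ^ 2 * G.m y := by
            gcongr
            exact h6.trans h5
        _ ≤ _ := h1.trans (h2.trans (by gcongr))
    have h8 : G.mu1 P * (v x ^ 2 * G.m x) ≤ 2 * M / k ^ 2 := by
      rw [mul_div_assoc]
      linarith
    rwa [le_div_iff₀ (by positivity)] at h8
  set b := G.mu1 P * (v x ^ 2 * G.m x) with hb
  have hb0 : 0 < b := by
    have := G.m_pos x
    positivity
  have hM0 : 0 ≤ M := ENNReal.toReal_nonneg
  -- Any large $k$ contradicts `key`. With $q=2M/b$ this one satisfies $k\ge1+q$, while `key` gives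
  -- $k^2\le q$.
  have h := key (2 * ρ x x₀ + 1 + 2 * M / b) (by
    have : 0 ≤ 2 * M / b := by positivity
    linarith)
  set q := 2 * M / b with hq
  have hq0 : 0 ≤ q := by positivity
  have hqb : 2 * M = b * q := by
    rw [hq]
    field_simp
  rw [hqb] at h
  have h9 := le_of_mul_le_mul_left h hb0
  nlinarith

/-- A set of finite volume with positive bottom of the spectrum is parabolic. -/
theorem isParabolic_of_vol_lt_top {ρ : V → V → ℝ} (hρ : G.IsAdmissibleMetric ρ) {P : Set V}
    (hμ : 0 < G.mu1 P) (x₀ : V) (hvol : G.vol P < ∞) : G.IsParabolic P := by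
  classical
  rintro ⟨f, hpos, hharm, hbd, hlim⟩
  set v : V → ℝ := fun x => if x ∈ P then 1 - min (f x) 1 else 0 with hvdef
  have hmin : ∀ x, 0 ≤ 1 - min (f x) 1 := fun x => sub_nonneg.2 (min_le_right _ _)
  have hv : ∀ x, 0 ≤ v x := fun x => by
    simp only [hvdef]
    split_ifs
    · exact hmin x
    · exact le_rfl
  have hzero := G.eq_zero_of_subharmonic hρ hμ x₀ hvol hv (fun x => by
      simp only [hvdef]
      split_ifs with hx
      · have : 0 ≤ min (f x) 1 := le_min (hpos x (Or.inl hx)).le zero_le_one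
        linarith
      · exact zero_le_one) (fun x hx => by simp [hvdef, hx]) (fun x hx hvx N hN => by
      have hvx' : v x = 1 - f x := by
        simp only [hvdef, hx, if_true] at hvx ⊢
        rcases le_total (f x) 1 with h | h
        · rw [min_eq_left h]
        · rw [min_eq_right h] at hvx
          simp at hvx
      have h0 : ∑ y ∈ N, G.w x y * (f y - f x) = 0 := by
        have h := hharm x hx
        rw [G.laplacian_eq_sum f hN, div_eq_zero_iff] at h
        exact h.resolve_right (G.m_pos x).ne'
      -- At a point with $v=1-f$, every neighbour has $v\ge1-f$: by truncation inside $P$, and by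
      -- $f=1$ on the boundary. Adding the vanishing sum for $f$ makes each term nonnegative.
      have : 0 ≤ ∑ y ∈ N, (G.w x y * (v y - v x) + G.w x y * (f y - f x)) := by
        refine Finset.sum_nonneg fun y _ => ?_
        rw [← mul_add]
        by_cases hxy : G.graph.Adj x y
        · refine mul_nonneg (G.w_nonneg x y) ?_
          by_cases hy : y ∈ P
          · have : min (f y) 1 ≤ f y := min_le_left _ _
            rw [hvx']
            simp only [hvdef, hy, if_true]
            linarith
          · rw [hvx', hbd y ⟨hy, x, hx, hxy.symm⟩]
            simp [hvdef, hy]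
        · simp [G.w_eq_zero x y hxy]
      rwa [Finset.sum_add_distrib, h0, add_zero] at this)
  refine absurd hlim (not_lt.2 ?_)
  refine le_liminf_of_le (by isBoundedDefault) ?_
  filter_upwards [mem_inf_of_right (mem_principal_self P)] with x hx
  have h := hzero x
  simp only [hvdef, hx, if_true] at h
  have : min (f x) 1 = 1 := by linarith
  exact_mod_cast min_eq_right_iff.1 this

end Caccioppoli

/-! ### Equilibrium potentials: parabolicity implies finite volume -/

section Capacity

variable {V : Type*} (G : WeightedGraph V)

-- First variation at one vertex: only edges at $x$ change, and each occurs as two ordered pairs.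
open Classical in
theorem sum_update_sub_sum (u : V → ℝ) {x : V} {N : Finset V} (hx : x ∈ N) (t : ℝ) :
    (∑ y ∈ N, ∑ z ∈ N, G.w y z * (Function.update u x t y - Function.update u x t z) ^ 2) -
      ∑ y ∈ N, ∑ z ∈ N, G.w y z * (u y - u z) ^ 2 =
      2 * ∑ z ∈ N, G.w x z * ((t - u z) ^ 2 - (u x - u z) ^ 2) := by
  set c : V → V → ℝ := fun y z => if y = x then G.w x z * ((t - u z) ^ 2 - (u x - u z) ^ 2) else 0
    with hc
  have h1 : ∀ y z, G.w y z * (Function.update u x t y - Function.update u x t z) ^ 2 -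
      G.w y z * (u y - u z) ^ 2 = c y z + c z y := by
    intro y z
    by_cases hy : y = x <;> by_cases hz : z = x
    · simp [hy, hz, hc, G.w_self]
    · subst hy
      simp [hz, hc]
      ring
    · subst hz
      simp only [hc, Function.update_self, Function.update_of_ne hy, hy, if_false, if_true,
        G.w_symm z y]
      ring
    · simp [hy, hz, hc]
  have h2 : ∑ y ∈ N, ∑ z ∈ N, c y z = ∑ z ∈ N, G.w x z * ((t - u z) ^ 2 - (u x - u z) ^ 2) := by
    rw [Finset.sum_eq_single_of_mem x hx]
    · simp [hc]
    · intro y _ hy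
      simp [hc, hy]
  have h3 : ∑ y ∈ N, ∑ z ∈ N, c z y = ∑ y ∈ N, ∑ z ∈ N, c y z := Finset.sum_comm
  simp only [← Finset.sum_sub_distrib, h1]
  simp only [Finset.sum_add_distrib]
  rw [h3, h2, two_mul]

open Classical in
/-- The equilibrium potential of `D` relative to `K ∪ D`: the minimizer of the energy among the
functions that are `1` on `D` and `0` off `K ∪ D`. -/
theorem exists_equilibrium (K D : Finset V) (hKD : Disjoint K D) :
    ∃ u : V → ℝ, (∀ x, u x ∈ Set.Icc (0 : ℝ) 1) ∧ (∀ x ∈ D, u x = 1) ∧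
      (∀ x, x ∉ K ∪ D → u x = 0) ∧ (∀ x ∈ K, G.laplacian u x = 0) ∧
      G.energy u ≤ G.energy (fun x => if x ∈ D then 1 else 0) := by
  set N := G.closedNbhd (K ∪ D) with hN
  set lo : V → ℝ := fun x => if x ∈ D then 1 else 0 with hlo
  set hi : V → ℝ := fun x => if x ∈ K ∪ D then 1 else 0 with hhi
  set S : Set (V → ℝ) := Set.pi Set.univ fun x => Set.Icc (lo x) (hi x) with hS
  set J : (V → ℝ) → ℝ := fun u => ∑ x ∈ N, ∑ y ∈ N, G.w x y * (u x - u y) ^ 2 with hJ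
  have hlohi : ∀ x, lo x ≤ hi x := fun x => by
    simp only [hlo, hhi, Finset.mem_union]
    split_ifs with h1 h2 h2
    · exact le_rfl
    · exact absurd (Or.inr h1) h2
    · exact zero_le_one
    · exact le_rfl
  have hloS : lo ∈ S := fun x _ => ⟨le_rfl, hlohi x⟩
  have hcont : Continuous J := by
    simp only [hJ]
    fun_prop
  obtain ⟨u, huS, hmin⟩ :=
    (isCompact_univ_pi fun x => isCompact_Icc (a := lo x) (b := hi x)).exists_isMinOn ⟨lo, hloS⟩
      hcont.continuousOn
  have hu0 : ∀ x, x ∉ K ∪ D → u x = 0 := fun x hx => by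
    have h := huS x (Set.mem_univ x)
    simp only [hlo, hhi, hx, if_false,
      show x ∉ D from fun h => hx (Finset.mem_union_right _ h)] at h
    exact le_antisymm h.2 h.1
  have hI : ∀ v ∈ S, ∀ x, v x ∈ Set.Icc (0 : ℝ) 1 := fun v hv x => by
    have h := hv x (Set.mem_univ x)
    refine ⟨le_trans ?_ h.1, h.2.trans ?_⟩
    · simp only [hlo]
      split_ifs <;> norm_num
    · simp only [hhi]
      split_ifs <;> norm_num
  refine ⟨u, hI u huS, fun x hx => ?_, hu0, fun x hx => ?_, ?_⟩
  · have h := huS x (Set.mem_univ x)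
    simp only [hlo, hhi, hx, if_true, Finset.mem_union_right K hx] at h
    exact le_antisymm h.2 h.1
  · have hxKD : x ∈ K ∪ D := Finset.mem_union_left _ hx
    have hxN : x ∈ N := G.subset_closedNbhd _ hxKD
    have hxD : x ∉ D := Finset.disjoint_left.1 hKD hx
    rw [G.laplacian_eq_sum u (G.nbr_subset_closedNbhd hxKD), div_eq_zero_iff]
    left
    change ∑ y ∈ N, G.w x y * (u y - u x) = 0
    set W := ∑ y ∈ N, G.w x y with hW
    set A := ∑ y ∈ N, G.w x y * u y with hA
    have hsum : ∑ y ∈ N, G.w x y * (u y - u x) = A - W * u x := by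
      rw [hA, hW, Finset.sum_mul, ← Finset.sum_sub_distrib]
      exact Finset.sum_congr rfl fun y _ => by ring
    have hW0 : 0 ≤ W := Finset.sum_nonneg fun y _ => G.w_nonneg x y
    have hA0 : 0 ≤ A :=
      Finset.sum_nonneg fun y _ => mul_nonneg (G.w_nonneg x y) (hI u huS y).1
    have hAW : A ≤ W :=
      Finset.sum_le_sum fun y _ => mul_le_of_le_one_right (G.w_nonneg x y) (hI u huS y).2
    rw [hsum]
    rcases hW0.eq_or_lt with hW0 | hW0
    · rw [← hW0] at hAW ⊢
      linarith
    -- The weighted mean of the neighbouring values lies in $[0,1]$, so it is an admissible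
    -- replacement for $u(x)$. Minimality then forces $(A-Wu(x))^2\le0$.
    set t := A / W with ht
    have htW : t * W = A := div_mul_cancel₀ _ hW0.ne'
    have hS' : Function.update u x t ∈ S := by
      intro y _
      by_cases hy : y = x
      · subst hy
        simp only [hlo, hhi, hxD, hxKD, if_true, if_false, Function.update_self]
        exact ⟨by positivity, (div_le_one hW0).2 hAW⟩
      · rw [Function.update_of_ne hy]
        exact huS y (Set.mem_univ y)
    have h1 : J u ≤ J (Function.update u x t) := hmin hS'
    have h2 := G.sum_update_sub_sum u hxN t
    have h3 : ∑ z ∈ N, G.w x z * ((t - u z) ^ 2 - (u x - u z) ^ 2) =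
        W * t ^ 2 - 2 * t * A - W * u x ^ 2 + 2 * u x * A := by
      rw [hA, hW]
      simp only [Finset.sum_mul, Finset.mul_sum, ← Finset.sum_sub_distrib,
        ← Finset.sum_add_distrib]
      exact Finset.sum_congr rfl fun y _ => by ring
    have h4 : 0 ≤ W * t ^ 2 - 2 * t * A - W * u x ^ 2 + 2 * u x * A := by
      rw [← h3]
      simp only [hJ] at h1
      linarith
    have h5 : (A - W * u x) ^ 2 ≤ 0 := by
      have h6 := mul_nonneg hW0.le h4
      have : W * (W * t ^ 2 - 2 * t * A - W * u x ^ 2 + 2 * u x * A) =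
          -(A - W * u x) ^ 2 + (t * W - A) ^ 2 := by ring
      rw [this, htW, sub_self] at h6
      linarith
    exact pow_eq_zero_iff two_ne_zero |>.1 (le_antisymm h5 (sq_nonneg _))
  · rw [G.energy_eq_sum (F := K ∪ D) hu0 hN.ge, G.energy_eq_sum (F := K ∪ D) (N := N)
      (fun x hx => if_neg fun h => hx (Finset.mem_union_right _ h)) hN.ge]
    have h : J u ≤ J lo := hmin hloS
    simp only [hJ] at h
    linarith

theorem energy_sub_le {f g : V → ℝ} {F : Finset V} (hf : ∀ x, x ∉ F → f x = 0)
    (hg : ∀ x, x ∉ F → g x = 0) :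
    G.energy (fun x => f x - g x) ≤ 2 * G.energy f + 2 * G.energy g := by
  rw [G.energy_eq_sum (F := F) (fun x hx => by simp [hf x hx, hg x hx]) le_rfl,
    G.energy_eq_sum hf le_rfl, G.energy_eq_sum hg le_rfl]
  have : ∑ x ∈ G.closedNbhd F, ∑ y ∈ G.closedNbhd F, G.w x y * (f x - g x - (f y - g y)) ^ 2 ≤
      ∑ x ∈ G.closedNbhd F, ∑ y ∈ G.closedNbhd F,
        (2 * (G.w x y * (f x - f y) ^ 2) + 2 * (G.w x y * (g x - g y) ^ 2)) := by
    refine Finset.sum_le_sum fun x _ => Finset.sum_le_sum fun y _ => ?_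
    have h1 := G.w_nonneg x y
    have h2 : (f x - g x - (f y - g y)) ^ 2 ≤ 2 * (f x - f y) ^ 2 + 2 * (g x - g y) ^ 2 := by
      nlinarith [sq_nonneg (f x - f y + (g x - g y))]
    nlinarith [mul_le_mul_of_nonneg_left h2 h1]
  simp only [Finset.sum_add_distrib, ← Finset.mul_sum] at this
  linarith

/-- The equilibrium potential of the boundary of `P` is square summable on `P`. -/
theorem exists_harmonic_sq_summable {P : Set V} (hμ : 0 < G.mu1 P)
    (hfin : (G.boundary P).Finite) :
    ∃ u : V → ℝ, (∀ x, 0 ≤ u x) ∧ (∀ x ∈ G.boundary P, u x = 1) ∧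
      (∀ x ∈ P, G.laplacian u x = 0) ∧
      ∃ C, ∀ F : Finset V, (∀ x ∈ F, x ∈ P) → ∑ x ∈ F, u x ^ 2 * G.m x ≤ C := by
  classical
  set D := hfin.toFinset with hD
  have hDP : ∀ x ∈ P, x ∉ D := fun x hx hxD => by
    simp only [hD, Set.Finite.mem_toFinset] at hxD
    exact hxD.1 hx
  set E := G.energy (fun x => if x ∈ D then 1 else 0) with hE
  choose U hU01 hUD hU0 hUh hUE using fun K : Finset V =>
    G.exists_equilibrium (K.filter (· ∈ P)) D
      (Finset.disjoint_left.2 fun x hx => hDP x (Finset.mem_filter.1 hx).2)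
  have hbound : ∀ K F : Finset V, F ⊆ K → (∀ x ∈ F, x ∈ P) →
      ∑ x ∈ F, U K x ^ 2 * G.m x ≤ 4 * E / G.mu1 P := by
    intro K F hFK hFP
    -- Subtracting the indicator of $D$ makes the potential vanish off $P$ without changing it on
    -- $P$. The energy is at most $2E+2E$, which gives the bound $4E/\mu$.
    set f : V → ℝ := fun x => U K x - if x ∈ D then 1 else 0 with hf
    have hfU : ∀ x, x ∈ P → f x = U K x := fun x hx => by simp [hf, hDP x hx]
    have hf0 : ∀ x, x ∉ K.filter (· ∈ P) → f x = 0 := fun x hx => by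
      by_cases hxD : x ∈ D
      · simp [hf, hxD, hUD K x hxD]
      · have := hU0 K x fun h => (Finset.mem_union.1 h).elim hx hxD
        simp [hf, hxD, this]
    have h1 := G.mu1_mul_sum_le_energy (P := P) hf0
      (fun x hx => hf0 x fun h => hx (Finset.mem_filter.1 h).2)
    have h2 := G.energy_sub_le (F := K.filter (· ∈ P) ∪ D) (hU0 K)
      (g := fun x => if x ∈ D then 1 else 0)
      (fun x hx => if_neg fun h => hx (Finset.mem_union_right _ h))
    rw [le_div_iff₀' hμ]
    have h3 : ∑ x ∈ F, U K x ^ 2 * G.m x ≤ ∑ x ∈ K.filter (· ∈ P), f x ^ 2 * G.m x := by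
      rw [Finset.sum_congr rfl fun x hx => by rw [← hfU x (hFP x hx)]]
      exact Finset.sum_le_sum_of_subset_of_nonneg
        (fun x hx => Finset.mem_filter.2 ⟨hFK hx, hFP x hx⟩)
        fun x _ _ => mul_nonneg (sq_nonneg _) (G.m_pos x).le
    have h4 := mul_le_mul_of_nonneg_left h3 hμ.le
    have h5 := hUE K
    change G.energy f ≤ _ at h2
    linarith
  -- Compactness of $[0,1]^V$ gives a pointwise limit along an ultrafilter finer than exhaustion by
  -- finite sets. Harmonicity and the norm bound involve finitely many vertices at a time, so they
  -- pass to the limit.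
  set 𝒰 : Ultrafilter (Finset V) := Ultrafilter.of atTop with h𝒰
  have hev : ∀ F : Finset V, ∀ᶠ K in (𝒰 : Filter (Finset V)), F ⊆ K := fun F =>
    Ultrafilter.of_le atTop (eventually_ge_atTop F)
  obtain ⟨u, -, hu⟩ := (isCompact_univ_pi fun _ : V =>
    isCompact_Icc (a := (0 : ℝ)) (b := 1)).ultrafilter_le_nhds (𝒰.map U) (by
      rw [le_principal_iff]
      exact Filter.mem_map.2 (Filter.univ_mem' fun K x _ => hU01 K x))
  have hlim : ∀ x, Tendsto (fun K => U K x) 𝒰 (𝓝 (u x)) := tendsto_pi_nhds.1 hu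
  refine ⟨u, fun x => ?_, fun x hx => ?_, fun x hx => ?_, 4 * E / G.mu1 P, fun F hF => ?_⟩
  · exact ge_of_tendsto' (hlim x) fun K => (hU01 K x).1
  · refine tendsto_nhds_unique (hlim x) (tendsto_const_nhds.congr fun K => ?_)
    exact (hUD K x (by simpa [hD] using hx)).symm
  · rw [G.laplacian_eq_sum u (le_refl (G.nbr x))]
    have h : Tendsto (fun K => (∑ y ∈ G.nbr x, G.w x y * (U K y - U K x)) / G.m x) 𝒰
        (𝓝 ((∑ y ∈ G.nbr x, G.w x y * (u y - u x)) / G.m x)) :=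
      (tendsto_finsetSum _ fun y _ => ((hlim y).sub (hlim x)).const_mul _).div_const _
    refine tendsto_nhds_unique h (tendsto_const_nhds.congr' ?_)
    filter_upwards [hev {x}] with K hK
    rw [← G.laplacian_eq_sum (U K) (le_refl (G.nbr x))]
    exact (hUh K x (Finset.mem_filter.2 ⟨hK (Finset.mem_singleton_self x), hx⟩)).symm
  · refine le_of_tendsto (tendsto_finsetSum F fun x _ => ((hlim x).pow 2).mul_const (G.m x)) ?_
    filter_upwards [hev F] with K hK
    exact hbound K F hK hF

/-- Minimum principle: a zero in $P$ spreads to all neighbours, hence through the connected end to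
its boundary, where $u=1$. -/
theorem IsEnd.pos_of_harmonic {G : WeightedGraph V} {P : Set V} (hP : G.IsEnd P)
    (hne : (G.boundary P).Nonempty) {u : V → ℝ} (h0 : ∀ x, 0 ≤ u x)
    (h1 : ∀ x ∈ G.boundary P, u x = 1) (hh : ∀ x ∈ P, G.laplacian u x = 0) :
    ∀ x ∈ P, 0 < u x := by
  intro x hx
  refine (h0 x).lt_of_ne' fun hux => ?_
  have hnbr : ∀ y ∈ P, u y = 0 → ∀ z, G.graph.Adj y z → u z = 0 := by
    intro y hy huy z hyz
    have h := hh y hy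
    rw [G.laplacian_eq_sum u (le_refl (G.nbr y)), div_eq_zero_iff] at h
    have h := h.resolve_right (G.m_pos y).ne'
    simp only [huy, sub_zero] at h
    rw [Finset.sum_eq_zero_iff_of_nonneg fun v _ => mul_nonneg (G.w_nonneg y v) (h0 v)] at h
    exact (mul_eq_zero.1 (h z (G.mem_nbr.2 hyz))).resolve_left (G.w_pos y z hyz).ne'
  obtain ⟨y, hy⟩ := hne
  obtain ⟨z, hz, hyz⟩ := hy.2
  have huz : u z = 0 := hP.forall_of_adj (p := fun v => u v = 0)
    (fun v hv w _ hvw huv => hnbr v hv huv w hvw) hx hux hz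
  have := hnbr z hz huz y hyz.symm
  rw [h1 y hy] at this
  exact one_ne_zero this

/-- With empty boundary the constant $1/2$ is a barrier. The case is not vacuous, since
$\Omega=\emptyset$ gives the end $V$. -/
theorem IsEnd.boundary_nonempty_of_isParabolic {G : WeightedGraph V} {P : Set V}
    (hP : G.IsEnd P) (hpar : G.IsParabolic P) : (G.boundary P).Nonempty := by
  by_contra hne
  rw [Set.not_nonempty_iff_eq_empty] at hne
  refine hpar ⟨fun _ => 1 / 2, fun _ _ => by norm_num, fun x _ => by simp [laplacian], by
    simp [hne], ?_⟩
  have : (cofinite ⊓ 𝓟 P).NeBot := cofinite_inf_principal_neBot_iff.2 hP.infinite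
  rw [liminf_const]
  exact_mod_cast (by norm_num : (1 / 2 : ℝ) < 1)

/-- A parabolic end with positive bottom of the spectrum has finite volume. -/
theorem IsEnd.vol_lt_top_of_isParabolic {G : WeightedGraph V} {P : Set V} (hP : G.IsEnd P)
    (hμ : 0 < G.mu1 P) (hpar : G.IsParabolic P) : G.vol P < ∞ := by
  classical
  obtain ⟨u, h0, h1, hh, C, hC⟩ := G.exists_harmonic_sq_summable hμ hP.finite_boundary
  have hpos := hP.pos_of_harmonic (hP.boundary_nonempty_of_isParabolic hpar) h0 h1 hh
  have hlim : ¬ liminf (fun x => (u x : EReal)) (cofinite ⊓ 𝓟 P) < 1 := fun h =>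
    hpar ⟨u, fun x hx => hx.elim (hpos x) fun hx => by simp [h1 x hx], hh, h1, h⟩
  have hhalf : ((1 / 2 : ℝ) : EReal) < liminf (fun x => (u x : EReal)) (cofinite ⊓ 𝓟 P) :=
    lt_of_lt_of_le (by exact_mod_cast (by norm_num : (1 / 2 : ℝ) < 1)) (not_lt.1 hlim)
  have hev := eventually_lt_of_lt_liminf hhalf
  rw [eventually_inf_principal, eventually_cofinite] at hev
  set S := hev.toFinset with hS
  refine (G.vol_le_of_forall_sum_le (c := ∑ x ∈ S, G.m x + 4 * C) fun F hF => ?_).trans_lt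
    ENNReal.ofReal_lt_top
  have hpt : ∀ x ∈ F, G.m x ≤ (if x ∈ S then G.m x else 0) + 4 * (u x ^ 2 * G.m x) := by
    intro x hx
    have hm := G.m_pos x
    split_ifs with hxS
    · have : 0 ≤ 4 * (u x ^ 2 * G.m x) := by positivity
      linarith
    · simp only [hS, Set.Finite.mem_toFinset, Set.mem_ofPred_eq, not_not] at hxS
      have hux : 1 / 2 < u x := by exact_mod_cast hxS (hF x hx)
      have : 1 ≤ 4 * u x ^ 2 := by nlinarith
      nlinarith
  have h := Finset.sum_le_sum hpt
  rw [Finset.sum_add_distrib, ← Finset.sum_filter, ← Finset.mul_sum] at h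
  have h2 : ∑ x ∈ F.filter (· ∈ S), G.m x ≤ ∑ x ∈ S, G.m x :=
    Finset.sum_le_sum_of_subset_of_nonneg (fun x hx => (Finset.mem_filter.1 hx).2)
      fun x _ _ => (G.m_pos x).le
  linarith [hC F hF]

end Capacity

/-! ### Nonemptiness of the reference annulus -/

section Annulus

variable {V : Type*} {G : WeightedGraph V}

/-- Starting from $\partial P$, no edge can jump over the annulus. If it were empty, all of $P$
would stay in $\{r<R_0\}$, which is finite. -/
theorem IsEnd.nonempty_annulusPart {ρ : V → V → ℝ} (hρ : G.IsAdmissibleMetric ρ) {P : Set V}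
    (hP : G.IsEnd P) (hs : 0 < G.jumpSize ρ) (hne : (G.boundary P).Nonempty) (x₀ : V) {R₀ : ℝ}
    (hR₀ : ∀ x ∈ G.boundary P, ρ x x₀ ≤ R₀) :
    (annulusPart ρ x₀ P R₀ (R₀ + 3 * G.jumpSize ρ)).Nonempty := by
  by_contra h
  rw [Set.not_nonempty_iff_eq_empty] at h
  have step : ∀ x ∈ P, ∀ y, G.graph.Adj y x → ρ y x₀ ≤ R₀ → ρ x x₀ < R₀ := by
    intro x hx y hyx hy
    by_contra! hxR
    have h1 := hρ.le_jumpSize hyx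
    have h2 := abs_le.1 (hρ.isIntrinsicMetric.abs_sub_le x₀ y x)
    have : x ∈ annulusPart ρ x₀ P R₀ (R₀ + 3 * G.jumpSize ρ) := ⟨hx, hxR, by linarith⟩
    rw [h] at this
    exact this
  obtain ⟨y, hy⟩ := hne
  obtain ⟨x, hx, hyx⟩ := hy.2
  refine hP.infinite ((hρ.finite_le x₀ R₀).subset fun z hz => ?_)
  exact (hP.forall_of_adj (p := fun v => ρ v x₀ < R₀)
    (fun v _ w hw hvw hv => step w hw v hvw hv.le) hx (step x hx y hyx (hR₀ y hy)) hz).le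

end Annulus

end WeightedGraph

/-- Finite volume is the hub: (1) and (3) are equivalent by potential theory, (2) gives (3) by the
first Agmon argument, and (3) gives (4) and (5) by the tail estimate. The remaining arrows are (5)
to (3) and (4) to (2). -/
theorem mainTheorem3 {V : Type*} [Infinite V] (G : WeightedGraph V)
    (ρ : V → V → ℝ) (hρ : G.IsAdmissibleMetric ρ) (x₀ : V)
    (P : Set V) (hP : G.IsEnd P) (hμ : 0 < G.mu1 P)
    (s : ℝ) (hs : s = G.jumpSize ρ) (a : ℝ) (ha : a = G.aCoeff ρ 0 (G.mu1 P))
    (R₀ : ℝ) (hR₀ : ∀ x ∈ G.boundary P, ρ x x₀ ≤ R₀) :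
    List.TFAE [
      G.IsParabolic P,
      ∃ R : ℕ → ℝ, Tendsto R atTop atTop ∧
        Tendsto (fun i => ∑' x : annulusPart ρ x₀ P (R i) (R i + 3 * s),
          ENNReal.ofReal (Real.exp (-2 * a * ρ x x₀) * G.m x)) atTop (𝓝 0),
      G.vol P < ∞,
      ∃ C : ℝ, 0 < C ∧ ∀ R : ℝ, R₀ + 3 * s ≤ R →
        G.vol (annulusPart ρ x₀ P R (R + 3 * s)) ≤
          ENNReal.ofReal (C * Real.exp (-2 * a * (R - R₀))) *
            G.vol (annulusPart ρ x₀ P R₀ (R₀ + 3 * s)),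
      ∃ C : ℝ, 0 < C ∧ ∀ R : ℝ, R₀ + 3 * s ≤ R →
        G.vol P - G.vol (ballPart ρ x₀ P R) ≤
          ENNReal.ofReal (C * Real.exp (-2 * a * (R - R₀))) *
            G.vol (annulusPart ρ x₀ P R₀ (R₀ + 3 * s))] := by
  subst hs
  have hs := hρ.jumpSize_pos
  obtain ⟨ha0, hexp⟩ := G.exp_edge_estimate hρ hμ (fun hd => by
    obtain ⟨x, hx, y, hy, hxy⟩ := hP.exists_adj
    exact G.mu1_lt_one_of_combDist hρ.isIntrinsicMetric hd hx hy hxy) ha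
  set s := G.jumpSize ρ with hsdef
  set v := G.vol (annulusPart ρ x₀ P R₀ (R₀ + 3 * s)) with hv
  have hvtop : v < ∞ := G.vol_lt_top_of_finite
    ((hρ.finite_le x₀ (R₀ + 3 * s)).subset fun _ hx => hx.2.2)
  have hdecay : G.vol P < ∞ → ∃ C : ℝ, 0 < C ∧ ∀ R : ℝ, G.vol {x ∈ P | R ≤ ρ x x₀} ≤
      ENNReal.ofReal (C * Real.exp (-2 * a * (R - R₀))) * v := by
    intro hvol
    obtain ⟨C, hC, htail⟩ := G.exists_vol_tail_le hρ hs hμ ha0 hexp x₀ hP.finite_boundary hvol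
    -- Normalizing by $v$ requires $v\ne0$. Finite volume gives parabolicity, hence a nonempty
    -- boundary and a nonempty annulus.
    have hne := hP.boundary_nonempty_of_isParabolic (G.isParabolic_of_vol_lt_top hρ hμ x₀ hvol)
    have hvpos : 0 < v := G.vol_pos_of_nonempty (hP.nonempty_annulusPart hρ hs hne x₀ hR₀)
    have hv0 : 0 < v.toReal := ENNReal.toReal_pos hvpos.ne' hvtop.ne
    refine ⟨C * Real.exp (-2 * a * R₀) / v.toReal, by positivity, fun R =>
      (htail R).trans_eq ?_⟩
    rw [← ENNReal.ofReal_toReal hvtop.ne, ← ENNReal.ofReal_mul (by positivity),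
      ENNReal.toReal_ofReal hv0.le]
    congr 1
    rw [show -2 * a * R = -2 * a * R₀ + -2 * a * (R - R₀) by ring, Real.exp_add]
    field_simp
  tfae_have 1 → 3 := fun h => hP.vol_lt_top_of_isParabolic hμ h
  tfae_have 3 → 1 := fun h => G.isParabolic_of_vol_lt_top hρ hμ x₀ h
  tfae_have 2 → 3 := fun ⟨R, hR, hlim⟩ =>
    G.vol_lt_top_of_tendsto hρ hs hμ ha0 hexp x₀ hP.finite_boundary hR hlim
  tfae_have 3 → 4 := fun h => by
    obtain ⟨C, hC, hb⟩ := hdecay h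
    exact ⟨C, hC, fun R _ => (G.vol_mono (Ω' := {x ∈ P | R ≤ ρ x x₀})
      fun x hx => ⟨hx.1, hx.2.1⟩).trans (hb R)⟩
  tfae_have 3 → 5 := fun h => by
    obtain ⟨C, hC, hb⟩ := hdecay h
    refine ⟨C, hC, fun R _ => le_trans ?_ (hb R)⟩
    rw [tsub_le_iff_right]
    refine (G.vol_mono (Ω' := {x ∈ P | R ≤ ρ x x₀} ∪ ballPart ρ x₀ P R) fun x hx => ?_).trans
      (ENNReal.tsum_union_le (fun x => ENNReal.ofReal (G.m x)) _ _)
    exact (le_total R (ρ x x₀)).imp (fun h => ⟨hx, h⟩) fun h => ⟨hx, h⟩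
  tfae_have 5 → 3 := fun ⟨C, _, h⟩ => by
    have h1 := h (R₀ + 3 * s) le_rfl
    rw [tsub_le_iff_right] at h1
    refine h1.trans_lt (ENNReal.add_lt_top.2
      ⟨ENNReal.mul_lt_top ENNReal.ofReal_lt_top hvtop, G.vol_lt_top_of_finite ?_⟩)
    exact (hρ.finite_le x₀ (R₀ + 3 * s)).subset fun _ hx => hx.2
  tfae_have 4 → 2 := fun ⟨C, hC, h⟩ => by
    refine ⟨fun i => i, tendsto_natCast_atTop_atTop, ?_⟩
    have hlim : Tendsto (fun i : ℕ => ENNReal.ofReal (Real.exp (-2 * a * i) * (C * v.toReal)))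
        atTop (𝓝 0) := by
      rw [← ENNReal.ofReal_zero]
      refine ENNReal.tendsto_ofReal ?_
      rw [← zero_mul (C * v.toReal)]
      refine (Real.tendsto_exp_atBot.comp ?_).mul_const _
      exact tendsto_natCast_atTop_atTop.const_mul_atTop_of_neg (by linarith)
    refine tendsto_of_tendsto_of_tendsto_of_le_of_le' tendsto_const_nhds hlim
      (Eventually.of_forall fun _ => zero_le) ?_
    filter_upwards [tendsto_natCast_atTop_atTop.eventually_ge_atTop (R₀ + 3 * s)] with i hi
    have h1 : ∑' x : annulusPart ρ x₀ P i (i + 3 * s),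
        ENNReal.ofReal (Real.exp (-2 * a * ρ x x₀) * G.m x) ≤
        ENNReal.ofReal (Real.exp (-2 * a * i)) * G.vol (annulusPart ρ x₀ P i (i + 3 * s)) := by
      unfold WeightedGraph.vol
      rw [← ENNReal.tsum_mul_left]
      refine ENNReal.tsum_le_tsum fun x => ?_
      rw [← ENNReal.ofReal_mul (Real.exp_pos _).le]
      refine ENNReal.ofReal_le_ofReal (mul_le_mul_of_nonneg_right ?_ (G.m_pos x).le)
      refine Real.exp_le_exp.2 ?_
      have := x.2.2.1
      nlinarith
    refine h1.trans ((mul_le_mul_right (h i hi) _).trans ?_)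
    rw [← ENNReal.ofReal_toReal hvtop.ne, ← ENNReal.ofReal_mul (by positivity),
      ← ENNReal.ofReal_mul (by positivity), ENNReal.toReal_ofReal ENNReal.toReal_nonneg]
    refine ENNReal.ofReal_le_ofReal ?_
    -- Only boundedness of the annulus volumes is used here; the decay comes from the weight
    -- $e^{-2ar}$ in (2).
    have : Real.exp (-2 * a * (i - R₀)) ≤ 1 := by
      refine Real.exp_le_one_iff.2 ?_
      nlinarith
    gcongr
    exact mul_le_of_le_one_right hC.le this
  tfae_finish
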